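/- All monoids and rings are commutative. A \emph{pointed monoid} is a monoid with an absorbing element $0$; for a ring $R$, $R^\bullet$ is its multiplicative pointed monoid. A pointed monoid is a \emph{domain} if it embeds, as a pointed monoid, into $K^\bullet$ for some field $K$. For a pointed monoid $k$ and a $k$-algebra $B$ (a morphism of pointed monoids $k\to B$), $\mathrm{SCong}_k B$ is the set of congruences $\mathfrak c$ on $B$ such that $B/\mathfrak c$ is a domain and $k\to B/\mathfrak c$ is injective, with the topology generated by the sets $\{\mathfrak c \mid (a,b)\notin\mathfrak c\}$, $a,b\in B$. The $k$-algebra $B$ is \emph{finitely generated} if there are $b_1,\dots,b_n\in B$ such that every element of $B$ is of the form $\lambda b_1^{m_1}\cdots b_n^{m_n}$ with $\lambda\in k$ and $m_i\in\mathbb N$. A \emph{monoid scheme} is a topological space with a sheaf of pointed monoids that is locally isomorphic to $\mathrm{MSpec}\,A$ (the space of prime ideals of a pointed monoid $A$ with its structure sheaf); morphisms are local on stalks. A \emph{$k$-scheme} is a monoid scheme $X$ with a morphism $X\to\mathrm{MSpec}\,k$. It is \emph{locally of finite type} if $\mathrm{MSpec}\,k$ has a covering by affine opens $V$ whose preimages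 have coverings by affine opens $W$ with $\Gamma(W)$ a finitely generated $\Gamma(V)$-algebra. Let $\mathrm{SCong}_k X:=\mathrm{colim}_U\,\mathrm{SCong}_k\,\Gamma(U)$, the colimit in topological spaces over the affine opens $U$ of $X$, with the pullback maps. A space is \emph{sober} if each irreducible closed subset has a unique generic point. \textbf{Theorem.} Let $k$ be a domain. (1) If $X$ is a $k$-scheme locally of finite type, then $\mathrm{SCong}_k X$ is sober. (2) Let $B$ be a finitely generated $k$-algebra. Then $\mathrm{SCong}_k B$ is sober and $T_0$. Moreover, for every field $F$ with an injective morphism of pointed monoids $k\to F^\bullet$, the ring $$R:=F[B]\,/\,\langle \lambda_F 1_B-1_F\lambda_B \mid \lambda\in k\rangle$$ is Noetherian, and the map sending $\mathfrak p\in\mathrm{Spec}\,R$ to the congruence kernel of $B\to (R/\mathfrak p)^\bullet$, $b\mapsto\overline{1_F b}$, is a continuous map from $\mathrm{Spec}\,R$ to the space of prime congruences of $B$ (with the topology generated by the same kind of sets), whose image is contained in $\mathrm{SCong}_k B$, and is equal to $\mathrm{SCong}_k B$ if $F$ has characteristic zero. There is a field $F$ of characteristic zero with an injective morphism $k\to F^\bullet$;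 in particular $\mathrm{SCong}_k B$ is the continuous image of the spectrum of a Noetherian ring. -/

import Mathlib

open CategoryTheory TopologicalSpace

universe u v w

namespace StrongCong

/-! ## Pointed monoids and congruences

A (commutative) pointed monoid is a `CommMonoidWithZero`, a morphism of pointed monoids is a
`MonoidWithZeroHom`, and a congruence is a Mathlib `Con` (an equivalence relation compatible with
the multiplication). -/

section Congruences

variable {A : Type u} [CommMonoidWithZero A] {B : Type v} [CommMonoidWithZero B]

/-- A pointed monoid is integral if `a * b = a * c` implies `a = 0` or `b = c`. -/
def IsIntegral (A : Type u) [CommMonoidWithZero A] : Prop :=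
  ∀ a b c : A, a * b = a * c → a = 0 ∨ b = c

/-- A domain is a pointed monoid that embeds into the multiplicative monoid of a field. -/
def IsPointedDomain (A : Type u) [CommMonoidWithZero A] : Prop :=
  ∃ (K : Type u) (_ : Field K) (i : A →*₀ K), Function.Injective i

/-- A `k`-algebra `f : k → A` is finitely generated if there are `a₁, …, aₙ` in `A` such that
every element of `A` is of the form `f c * a₁ ^ m₁ * ⋯ * aₙ ^ mₙ`. -/
def IsFinitelyGenerated (f : A →*₀ B) : Prop :=
  ∃ (n : ℕ) (b : Fin n → B), ∀ x : B, ∃ (c : A) (m : Fin n → ℕ), x = f c * ∏ i, b i ^ m i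

/-- The quotient of a pointed monoid by a congruence is a pointed monoid with zero `[0]`. -/
instance quotientCommMonoidWithZero (c : Con A) : CommMonoidWithZero c.Quotient where
  zero := ((0 : A) : c.Quotient)
  zero_mul := by
    intro q
    induction q using Con.induction_on with
    | H a => exact congrArg (fun x : A => (x : c.Quotient)) (zero_mul a)
  mul_zero := by
    intro q
    induction q using Con.induction_on with
    | H a => exact congrArg (fun x : A => (x : c.Quotient)) (mul_zero a)

/-- The projection `A → A / c`. -/
def proj (c : Con A) : A →*₀ c.Quotient where
  toFun a := (a : c.Quotient)
  map_zero' := rfl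
  map_one' := rfl
  map_mul' _ _ := rfl

/-- A congruence is prime if its quotient is nonzero and integral. -/
def IsPrimeCon (c : Con A) : Prop := Nontrivial c.Quotient ∧ IsIntegral c.Quotient

/-- The set of prime congruences of `A`. -/
def Cong (A : Type u) [CommMonoidWithZero A] : Type u := {c : Con A // IsPrimeCon c}

/-- The set of prime congruences not containing `(a, b)`. -/
def Cong.basicOpen (a b : A) : Set (Cong A) := {c | ¬ c.1 a b}

/-- The topology of the congruence space: the coarsest one in which all `U_{a, b}` are open. -/
instance : TopologicalSpace (Cong A) :=
  generateFrom {U | ∃ a b : A, U = Cong.basicOpen a b}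

/-- The pullback of a congruence along a morphism. -/
def pullback (f : A →*₀ B) (d : Con B) : Con A := Con.comap f (map_mul f) d

theorem pullback_iff (f : A →*₀ B) (d : Con B) (a b : A) :
    pullback f d a b ↔ d (f a) (f b) := Iff.rfl

/-- The injection of `A / f^* d` into `B / d`. -/
def pullbackMap (f : A →*₀ B) (d : Con B) : (pullback f d).Quotient →*₀ d.Quotient where
  toFun := Quotient.map f (fun _ _ h => h)
  map_zero' := congrArg (fun x : B => (x : d.Quotient)) (map_zero f)
  map_one' := congrArg (fun x : B => (x : d.Quotient)) (map_one f)
  map_mul' := by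
    intro x y
    induction x, y using Con.induction_on₂ with
    | H a b => exact congrArg (fun x : B => (x : d.Quotient)) (map_mul f a b)

theorem pullbackMap_injective (f : A →*₀ B) (d : Con B) :
    Function.Injective (pullbackMap f d) := by
  intro x y h
  induction x, y using Con.induction_on₂ with
  | H a b => exact (Con.eq _).2 ((Con.eq d).1 h)

theorem isPrimeCon_of_injective (c : Con A) (i : c.Quotient →*₀ B)
    (hi : Function.Injective i) (hB : Nontrivial B ∧ IsIntegral B) : IsPrimeCon c := by
  obtain ⟨hB, hB'⟩ := hB
  refine ⟨⟨⟨0, 1, fun h => ?_⟩⟩, fun x y z h => ?_⟩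
  · have := congrArg i h
    rw [map_zero, map_one] at this
    exact zero_ne_one this
  · have := congrArg i h
    rw [map_mul, map_mul] at this
    rcases hB' _ _ _ this with h | h
    · exact Or.inl (hi (by rw [h, map_zero]))
    · exact Or.inr (hi h)

/-- The continuous map `f^* : Cong B → Cong A`. -/
def Cong.pullback (f : A →*₀ B) (d : Cong B) : Cong A :=
  ⟨StrongCong.pullback f d.1,
    isPrimeCon_of_injective _ (pullbackMap f d.1) (pullbackMap_injective f d.1) d.2⟩

theorem Cong.continuous_pullback (f : A →*₀ B) : Continuous (Cong.pullback f) := by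
  refine continuous_generateFrom_iff.2 ?_
  rintro _ ⟨a, b, rfl⟩
  exact isOpen_generateFrom_of_mem ⟨f a, f b, rfl⟩

/-- `SCong_k A` for a `k`-algebra `f : k → A`, as a subset of the congruence space of `A`:
the congruences `c` such that `A / c` is a domain and `k → A / c` is injective. (A congruence
whose quotient is a domain is automatically prime.) As a type it has the subspace topology. -/
def SCong (f : A →*₀ B) : Set (Cong B) :=
  {c | IsPointedDomain c.1.Quotient ∧ Function.Injective ((proj c.1).comp f)}

/-- Pullback along a morphism `g : B → C` of `A`-algebras maps `SCong_A C` to `SCong_A B`. -/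
theorem SCong.pullback_mem {C : Type v} [CommMonoidWithZero C] (f : A →*₀ B) (g : B →*₀ C)
    (h : A →*₀ C) (hgf : g.comp f = h) (d : Cong C) (hd : d ∈ SCong h) :
    Cong.pullback g d ∈ SCong f := by
  subst hgf
  obtain ⟨⟨K, hK, i, hi⟩, hd⟩ := hd
  refine ⟨⟨K, hK, i.comp (pullbackMap g d.1), hi.comp (pullbackMap_injective g d.1)⟩, ?_⟩
  intro x y hxy
  exact hd (congrArg (pullbackMap g d.1) hxy)

/-- The continuous map `SCong_A C → SCong_A B` induced by a morphism of `A`-algebras `B → C`. -/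
def SCong.map {C : Type v} [CommMonoidWithZero C] (f : A →*₀ B) (g : B →*₀ C)
    (h : A →*₀ C) (hgf : g.comp f = h) : C(SCong h, SCong f) where
  toFun d := ⟨Cong.pullback g d.1, SCong.pullback_mem f g h hgf d.1 d.2⟩
  continuous_toFun :=
    ((Cong.continuous_pullback g).comp continuous_subtype_val).subtype_mk _

end Congruences

/-- A space is sober if every irreducible closed subset has a unique generic point. -/
def IsSober (T : Type u) [TopologicalSpace T] : Prop :=
  ∀ Z : Set T, IsIrreducible Z → IsClosed Z → ∃! x : T, IsGenericPoint x Z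

/-! ## Monoidal spaces -/

/-- A topological space with a sheaf of pointed monoids. -/
structure MonoidalSpace : Type (u + 1) where
  carrier : Type u
  [top : TopologicalSpace carrier]
  /-- The sections of the structure sheaf. -/
  sec : Opens carrier → Type u
  [inst : ∀ U, CommMonoidWithZero (sec U)]
  /-- The restriction maps. -/
  res : ∀ {U V : Opens carrier}, U ≤ V → sec V →*₀ sec U
  res_refl : ∀ (U : Opens carrier) (s : sec U), res (le_refl U) s = s
  res_res : ∀ {U V W : Opens carrier} (h : U ≤ V) (h' : V ≤ W) (s : sec W),
    res h (res h' s) = res (h.trans h') s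
  /-- Compatible families of sections on a covering glue uniquely. -/
  glue : ∀ {ι : Type u} (U : Opens carrier) (V : ι → Opens carrier) (hV : ∀ i, V i ≤ U)
    (_ : ∀ x ∈ U, ∃ i, x ∈ V i) (s : ∀ i, sec (V i))
    (_ : ∀ i j, res (inf_le_left : V i ⊓ V j ≤ V i) (s i) =
      res (inf_le_right : V i ⊓ V j ≤ V j) (s j)),
    ∃! t : sec U, ∀ i, res (hV i) t = s i

attribute [instance] MonoidalSpace.top MonoidalSpace.inst

instance : CoeSort MonoidalSpace.{u} (Type u) := ⟨MonoidalSpace.carrier⟩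

namespace MonoidalSpace

/-- The transition maps between the sections over the open neighbourhoods of a point, ordered by
reverse inclusion. -/
def nhdsRes (X : MonoidalSpace.{u}) (x : X) (U V : (OpenNhdsOf x)ᵒᵈ) (h : U ≤ V) :
    X.sec (OrderDual.ofDual U).toOpens →*₀ X.sec (OrderDual.ofDual V).toOpens :=
  X.res h

instance directedSystem (X : MonoidalSpace.{u}) (x : X) :
    DirectedSystem (fun U : (OpenNhdsOf x)ᵒᵈ => X.sec (OrderDual.ofDual U).toOpens)
      (fun U V h => X.nhdsRes x U V h) where
  map_self _ s := X.res_refl _ s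
  map_map _ _ _ _ _ s := X.res_res _ _ s

/-- The stalk of the structure sheaf. -/
abbrev stalk (X : MonoidalSpace.{u}) (x : X) : Type u :=
  DirectLimit (fun U : (OpenNhdsOf x)ᵒᵈ => X.sec (OrderDual.ofDual U).toOpens) (X.nhdsRes x)

/-- The germ of a section. -/
def germ (X : MonoidalSpace.{u}) (x : X) (U : Opens X) (hx : x ∈ U) (s : X.sec U) : X.stalk x :=
  Quotient.mk _ ⟨OrderDual.toDual (⟨U, hx⟩ : OpenNhdsOf x), s⟩

/-- A morphism of monoidal spaces: a continuous map with a morphism of sheaves of pointed monoids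
that is local on stalks. -/
structure Hom (X Y : MonoidalSpace.{u}) where
  base : C(X, Y)
  app : ∀ V : Opens Y, Y.sec V →*₀ X.sec (Opens.comap base V)
  naturality : ∀ {V W : Opens Y} (h : V ≤ W) (s : Y.sec W),
    app V (Y.res h s) = X.res (OrderHomClass.mono (Opens.comap base) h) (app W s)
  /-- The stalk map at `x`, which sends the germ of `s` at `base x` to the germ of `app V s`
  at `x`, is a local morphism: it reflects invertibility. -/
  isLocal : ∀ (x : X) (V : Opens Y) (hx : base x ∈ V) (s : Y.sec V),
    IsUnit (X.germ x (Opens.comap base V) hx (app V s)) → IsUnit (Y.germ (base x) V hx s)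

instance : Category MonoidalSpace.{u} where
  Hom := Hom
  id X :=
    { base := ContinuousMap.id X
      app := fun V => MonoidWithZeroHom.id (X.sec V)
      naturality := fun _ _ => rfl
      isLocal := fun _ _ _ _ h => h }
  comp {X Y Z} f g :=
    { base := g.base.comp f.base
      app := fun V => (f.app (Opens.comap g.base V)).comp (g.app V)
      naturality := fun {V W} h s =>
        (congrArg (f.app (Opens.comap g.base V)) (g.naturality h s)).trans (f.naturality _ _)
      isLocal := fun x V hx s h =>
        g.isLocal (f.base x) V hx s (f.isLocal x (Opens.comap g.base V) hx (g.app V s) h) }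

/-- The image in `X` of an open subset of the open subspace `U`. -/
def image {X : MonoidalSpace.{u}} (U : Opens X) (V : Opens U) : Opens X :=
  ⟨Subtype.val '' (V : Set U), U.2.isOpenMap_subtype_val _ V.2⟩

theorem image_mono {X : MonoidalSpace.{u}} (U : Opens X) {V W : Opens U} (h : V ≤ W) :
    image U V ≤ image U W := Set.image_mono h

/-- The open subspace `U` of `X` with the restricted sheaf. -/
def restrict (X : MonoidalSpace.{u}) (U : Opens X) : MonoidalSpace.{u} where
  carrier := U
  sec V := X.sec (image U V)
  res h := X.res (image_mono U h)
  res_refl _ s := X.res_refl _ s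
  res_res _ _ s := X.res_res _ _ s
  glue {ι} W V hV hc s hs := by
    refine X.glue (image U W) (fun i => image U (V i)) (fun i => image_mono U (hV i)) ?_ s ?_
    · rintro _ ⟨x, hx, rfl⟩
      obtain ⟨i, hi⟩ := hc x hx
      exact ⟨i, x, hi, rfl⟩
    · intro i j
      have h : image U (V i) ⊓ image U (V j) ≤ image U (V i ⊓ V j) := by
        rintro _ ⟨⟨x, hx, rfl⟩, ⟨y, hy, hxy⟩⟩
        obtain rfl := Subtype.val_injective hxy
        exact ⟨y, ⟨hx, hy⟩, rfl⟩
      have := congrArg (X.res h) (hs i j)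
      rw [X.res_res, X.res_res] at this
      exact this

end MonoidalSpace

/-! ## Affine monoid schemes -/

/-- The prime ideals of a pointed monoid (as usual, prime ideals are proper). -/
@[ext]
structure MSpec (A : Type u) [CommMonoidWithZero A] where
  ideal : Set A
  zero_mem : (0 : A) ∈ ideal
  mul_mem : ∀ a : A, ∀ x ∈ ideal, a * x ∈ ideal
  one_notMem : (1 : A) ∉ ideal
  mem_or_mem : ∀ a b : A, a * b ∈ ideal → a ∈ ideal ∨ b ∈ ideal

namespace MSpec

variable {A : Type u} [CommMonoidWithZero A]

/-- The complement of a prime ideal. -/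
def compl (p : MSpec A) : Submonoid A where
  carrier := p.idealᶜ
  one_mem' := p.one_notMem
  mul_mem' ha hb h := (p.mem_or_mem _ _ h).elim ha hb

/-- The principal open `U_h`. -/
def basicOpen (h : A) : Set (MSpec A) := {p | h ∉ p.ideal}

/-- The topology of `MSpec A`, generated by the principal opens. -/
instance : TopologicalSpace (MSpec A) := generateFrom {U | ∃ h : A, U = basicOpen h}

/-- A family of elements of the localizations `A_p`, for `p` in `U`, that is locally given by a
fraction `a / h`. -/
def IsLocallyFraction {U : Opens (MSpec A)} (s : ∀ p : U, Localization p.1.compl) : Prop :=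
  ∀ p : U, ∃ V : Opens (MSpec A), p.1 ∈ V ∧ ∃ hVU : V ≤ U, ∃ a h : A,
    ∀ (q : MSpec A) (hq : q ∈ V), ∃ hh : h ∈ q.compl,
      s ⟨q, hVU hq⟩ = Localization.mk a ⟨h, hh⟩

/-- The pointed monoid of all families of elements of the localizations. -/
abbrev Families (U : Opens (MSpec A)) : Type u := ∀ p : U, Localization p.1.compl

/-- The sections of the structure sheaf of `MSpec A` over `U`; over `U_h` they are the elements of
`A[h⁻¹]`. -/
def Sec (U : Opens (MSpec A)) : Type u := {s : Families U // IsLocallyFraction s}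

theorem Sec.ext {U : Opens (MSpec A)} {s t : Sec U} (h : ∀ p, s.1 p = t.1 p) : s = t :=
  Subtype.ext (funext h)

theorem isLocallyFraction_mk (U : Opens (MSpec A)) (a : A) :
    IsLocallyFraction (U := U) (fun p => Localization.mk a (1 : p.1.compl)) :=
  fun p => ⟨U, p.2, le_rfl, a, 1, fun q _ => ⟨q.compl.one_mem, rfl⟩⟩

theorem isLocallyFraction_mul {U : Opens (MSpec A)} {s t : Families U}
    (hs : IsLocallyFraction s) (ht : IsLocallyFraction t) : IsLocallyFraction (s * t) := by
  intro p
  obtain ⟨V, hpV, hVU, a, h, H⟩ := hs p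
  obtain ⟨W, hpW, hWU, b, g, G⟩ := ht p
  refine ⟨V ⊓ W, ⟨hpV, hpW⟩, inf_le_left.trans hVU, a * b, h * g, fun q hq => ?_⟩
  obtain ⟨hh, H⟩ := H q hq.1
  obtain ⟨hg, G⟩ := G q hq.2
  refine ⟨q.compl.mul_mem hh hg, ?_⟩
  rw [Pi.mul_apply, H, G, Localization.mk_mul]
  rfl

instance (U : Opens (MSpec A)) : CommMonoidWithZero (Sec U) where
  mul s t := ⟨s.1 * t.1, isLocallyFraction_mul s.2 t.2⟩
  one := ⟨1, by
    have := isLocallyFraction_mk U (1 : A)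
    simp only [Localization.mk_one] at this
    exact this⟩
  zero := ⟨0, by
    have := isLocallyFraction_mk U (0 : A)
    simp only [Localization.mk_zero] at this
    exact this⟩
  mul_assoc s t r := Subtype.ext (mul_assoc s.1 t.1 r.1)
  mul_comm s t := Subtype.ext (mul_comm s.1 t.1)
  one_mul s := Subtype.ext (one_mul s.1)
  mul_one s := Subtype.ext (mul_one s.1)
  zero_mul s := Subtype.ext (zero_mul s.1)
  mul_zero s := Subtype.ext (mul_zero s.1)

/-- Restriction of sections. -/
def Sec.res {U V : Opens (MSpec A)} (h : U ≤ V) : Sec V →*₀ Sec U where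
  toFun s := ⟨fun p => s.1 ⟨p.1, h p.2⟩, fun p => by
    obtain ⟨W, hpW, hWV, a, g, G⟩ := s.2 ⟨p.1, h p.2⟩
    exact ⟨W ⊓ U, ⟨hpW, p.2⟩, inf_le_right, a, g, fun q hq => G q hq.1⟩⟩
  map_zero' := rfl
  map_one' := rfl
  map_mul' _ _ := rfl

variable (A) in
/-- The affine monoid scheme of `A`. -/
def space : MonoidalSpace.{u} where
  carrier := MSpec A
  sec := Sec
  res := Sec.res
  res_refl _ _ := rfl
  res_res _ _ _ := rfl
  glue {ι} U V hV hc s hs := by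
    have key : ∀ (p : MSpec A) (i j : ι) (hi : p ∈ V i) (hj : p ∈ V j),
        (s i).1 ⟨p, hi⟩ = (s j).1 ⟨p, hj⟩ := fun p i j hi hj =>
      congrArg (fun t : Sec (V i ⊓ V j) => t.1 ⟨p, hi, hj⟩) (hs i j)
    choose c hc using hc
    refine ⟨⟨fun p => (s (c p.1 p.2)).1 ⟨p.1, hc p.1 p.2⟩, fun p => ?_⟩, fun i => ?_, ?_⟩
    · obtain ⟨W, hpW, hWV, a, g, G⟩ := (s (c p.1 p.2)).2 ⟨p.1, hc p.1 p.2⟩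
      refine ⟨W, hpW, hWV.trans (hV _), a, g, fun q hq => ?_⟩
      obtain ⟨hg, G⟩ := G q hq
      exact ⟨hg, (key q _ _ (hc q _) (hWV hq)).trans G⟩
    · exact Sec.ext fun p => key p.1 _ _ _ p.2
    · intro t ht
      refine Sec.ext fun p => ?_
      exact congrArg (fun r : Sec (V (c p.1 p.2)) => r.1 ⟨p.1, hc p.1 p.2⟩) (ht (c p.1 p.2))

/-- The morphism from `A` to the sections of the structure sheaf of `MSpec A`. -/
def toSec (U : Opens (MSpec A)) : A →*₀ Sec U where
  toFun a := ⟨fun p => Localization.mk a (1 : p.1.compl), isLocallyFraction_mk U a⟩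
  map_zero' := Sec.ext fun p => Localization.mk_zero _
  map_one' := Sec.ext fun p => Localization.mk_one
  map_mul' a b := Sec.ext fun p => by
    change Localization.mk (a * b) 1 = Localization.mk a 1 * Localization.mk b 1
    rw [Localization.mk_mul, one_mul]

end MSpec

/-! ## Monoid schemes -/

namespace MonoidalSpace

/-- An affine open: an open subspace isomorphic to `MSpec A` for some pointed monoid `A`. -/
def IsAffineOpen (X : MonoidalSpace.{u}) (U : Opens X) : Prop :=
  ∃ (A : Type u) (_ : CommMonoidWithZero A), Nonempty (X.restrict U ≅ MSpec.space A)

/-- A monoid scheme is a monoidal space with an open covering by affine monoid schemes. -/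
def IsMonoidScheme (X : MonoidalSpace.{u}) : Prop :=
  ∀ x : X, ∃ U : Opens X, x ∈ U ∧ X.IsAffineOpen U

/-- The map `Γ(Y, V) → Γ(X, W)` induced by `f : X ⟶ Y`, for `W` contained in the preimage
of `V`. -/
def Hom.appLE {X Y : MonoidalSpace.{u}} (f : X ⟶ Y) (V : Opens Y) (W : Opens X)
    (h : W ≤ Opens.comap (Hom.base f) V) : Y.sec V →*₀ X.sec W :=
  (X.res h).comp (Hom.app f V)

/-- A morphism `f : X ⟶ Y` is locally of finite type if `Y` has a covering by affine opens `V`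
such that each preimage of `V` has a covering by affine opens `W` with `Γ(X, W)` a finitely
generated `Γ(Y, V)`-algebra. -/
def IsLocallyOfFiniteType {X Y : MonoidalSpace.{u}} (f : X ⟶ Y) : Prop :=
  ∃ 𝒱 : Set (Opens Y), sSup 𝒱 = ⊤ ∧ ∀ V ∈ 𝒱, Y.IsAffineOpen V ∧
    ∃ 𝒲 : Set (Opens X), sSup 𝒲 = Opens.comap (Hom.base f) V ∧
      ∀ W ∈ 𝒲, X.IsAffineOpen W ∧ ∃ h : W ≤ Opens.comap (Hom.base f) V,
        IsFinitelyGenerated (Hom.appLE f V W h)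

/-- The affine opens of `X`, ordered by inclusion. -/
def AffineOpens (X : MonoidalSpace.{u}) : Type u := {U : Opens X // X.IsAffineOpen U}

instance (X : MonoidalSpace.{u}) : PartialOrder X.AffineOpens :=
  inferInstanceAs (PartialOrder {U : Opens X // X.IsAffineOpen U})

variable {k : Type u} [CommMonoidWithZero k] {X : MonoidalSpace.{u}}

/-- For a `k`-scheme `f : X ⟶ MSpec k`, the `k`-algebra structure on the sections over `U`. -/
def structureMap (f : X ⟶ MSpec.space k) (U : Opens X) : k →*₀ X.sec U :=
  (Hom.appLE f ⊤ U (fun _ _ => trivial)).comp (MSpec.toSec ⊤)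

theorem res_comp_structureMap (f : X ⟶ MSpec.space k) {U V : Opens X} (h : U ≤ V) :
    (X.res h).comp (structureMap f V) = structureMap f U :=
  MonoidWithZeroHom.ext fun _ => X.res_res _ _ _

/-- The diagram of the spaces `SCong_k Γ(X, U)`, for `U` an affine open of `X`. -/
def scongDiagram (f : X ⟶ MSpec.space k) : X.AffineOpens ⥤ TopCat.{u} where
  obj U := TopCat.of (SCong (structureMap f U.1))
  map {U V} i := TopCat.ofHom (SCong.map (structureMap f V.1) (X.res (leOfHom i))
    (structureMap f U.1) (res_comp_structureMap f (leOfHom i)))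
  map_id U := by
    refine TopCat.hom_ext (ContinuousMap.ext fun d => Subtype.ext (Subtype.ext (Con.ext fun a b => ?_)))
    change d.1.1 (X.res (le_refl U.1) a) (X.res (le_refl U.1) b) ↔ d.1.1 a b
    rw [X.res_refl, X.res_refl]
  map_comp {U V W} i j := by
    refine TopCat.hom_ext (ContinuousMap.ext fun d => Subtype.ext (Subtype.ext (Con.ext fun a b => ?_)))
    change d.1.1 (X.res (leOfHom (i ≫ j)) a) (X.res (leOfHom (i ≫ j)) b) ↔
      d.1.1 (X.res (leOfHom i) (X.res (leOfHom j) a)) (X.res (leOfHom i) (X.res (leOfHom j) b))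
    rw [X.res_res, X.res_res]

/-- The strong `k`-congruence space `SCong_k X` of a `k`-scheme: the colimit, in topological
spaces, of the `SCong_k Γ(X, U)` over the affine opens `U` of `X`. -/
noncomputable def scongSpace (f : X ⟶ MSpec.space k) : TopCat.{u} :=
  Limits.colimit (scongDiagram f)

end MonoidalSpace

/-! ## The comparison with prime spectra of rings -/

section Comparison

variable {k : Type u} [CommMonoidWithZero k] {B : Type v} [CommMonoidWithZero B]
  {F : Type w} [Field F]

/-- The ideal of the monoid algebra `F[B]` generated by the elements `λ_F 1_B - 1_F λ_B`
for `λ` in `k`. -/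
noncomputable def relIdeal (f : k →*₀ B) (i : k →*₀ F) : Ideal (MonoidAlgebra F B) :=
  Ideal.span {x | ∃ c : k, x = MonoidAlgebra.single 1 (i c) - MonoidAlgebra.single (f c) 1}

/-- The ring `R = F[B] / ⟨λ_F 1_B - 1_F λ_B | λ ∈ k⟩`. -/
abbrev RelRing (f : k →*₀ B) (i : k →*₀ F) : Type (max v w) :=
  MonoidAlgebra F B ⧸ relIdeal f i

/-- The morphism of pointed monoids `B → R` sending `b` to the class of `1_F b`. -/
noncomputable def toRelRing (f : k →*₀ B) (i : k →*₀ F) : B →*₀ RelRing f i where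
  toFun b := Ideal.Quotient.mk (relIdeal f i) (MonoidAlgebra.of F B b)
  map_zero' := by
    have h : MonoidAlgebra.single (1 : B) (i 0) - MonoidAlgebra.single (f 0) (1 : F) ∈
        relIdeal f i := Ideal.subset_span ⟨0, rfl⟩
    rw [map_zero, map_zero, MonoidAlgebra.single_zero, zero_sub, neg_mem_iff] at h
    exact Ideal.Quotient.eq_zero_iff_mem.2 h
  map_one' := by rw [map_one, map_one]
  map_mul' a b := by rw [map_mul, map_mul]

/-- The composition `B → R → R / p`. -/
def toResidue {R : Type w} [CommRing R] (φ : B →*₀ R) (p : PrimeSpectrum R) :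
    B →*₀ R ⧸ p.asIdeal :=
  (Ideal.Quotient.mk p.asIdeal).toMonoidWithZeroHom.comp φ

/-- The map `φ^* : Spec R → Cong B` induced by a morphism `φ : B → R` of pointed monoids: it sends
`p` to the congruence kernel of `B → R → R / p`. -/
def specToCong {R : Type w} [CommRing R] (φ : B →*₀ R) (p : PrimeSpectrum R) : Cong B :=
  ⟨Con.ker (toResidue φ p), by
    let j : (Con.ker (toResidue φ p)).Quotient →*₀ R ⧸ p.asIdeal :=
      { Con.kerLift ((toResidue φ p : B →*₀ R ⧸ p.asIdeal) : B →* R ⧸ p.asIdeal) with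
        map_zero' := map_zero (toResidue φ p) }
    refine isPrimeCon_of_injective _ j
      (Con.kerLift_injective ((toResidue φ p : B →*₀ R ⧸ p.asIdeal) : B →* R ⧸ p.asIdeal)) ?_
    exact ⟨inferInstance, fun a b c h => (mul_eq_mul_left_iff.1 h).symm⟩⟩

end Comparison

end StrongCong

/-! The affine case rests on one surjection: if `F` has characteristic zero, every strong congruence
is the congruence kernel of `B → R / p` for some prime `p` of `R`. Since `k` maps to scalars, `R` is
generated over `F` by the classes of finitely many `b_j`, so `Spec R` is a Noetherian sober space. A
continuous image of such a space is quasi-sober, and congruence spaces are `T0` because basic opens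
separate congruences.

The surjection is an amalgamation problem. A strong congruence gives an embedding of `B / c` into
some field `K`, with no relation to `F` beyond the common submonoid `k`. What is needed is a field
`L` over `F` and an injective multiplicative map `K → L` that agrees with `k → F → L` on `k`; then
`F[B] → L` kills the relations and its kernel yields `p`. The fractions of `k` give an isomorphism
between a subgroup of `Kˣ` and one of `Lˣ`. By Zorn it extends to a maximal one, and its domain is
all of `Kˣ` if `L` is algebraically closed of characteristic zero and large: roots are handled by
`Maximal.exists_of_prime_pow`, and an element of infinite order modulo the domain is sent to a free
element of `Lˣ`, found by Cantor's theorem (`Maximal.exists_mem`).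

For the global case, the spectrum of a nonzero pointed monoid has a unique closed point, whose only
open neighbourhood is the whole space. So an affine open inside an affine open is principal, and any
open covering of a nonempty affine open has a member containing it. The first fact makes the
transition maps of the colimit open embeddings (`SCong.isOpenEmbedding_map`), compatible with
intersections inside an affine open; hence the affine pieces embed as an open cover of the colimit
(`isOpenEmbedding_scongι`). The second shows that every affine open has finitely generated sections.
Sobriety is then checked on the pieces. -/

namespace StrongCong

/-! ## Amalgamation of multiplicative groups of fields -/

section Amalgamation

/-- A subgroup of a product of groups is bi-injective if it is the graph of an isomorphism between
a subgroup of the first factor and a subgroup of the second factor. -/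
def BiInjective {G : Type v} {H : Type w} [Group G] [Group H] (Γ : Subgroup (G × H)) : Prop :=
  ∀ p ∈ Γ, p.1 = 1 ↔ p.2 = 1

variable {G : Type v} {H : Type w} [CommGroup G] [CommGroup H]

theorem BiInjective.fst_eq_iff {Γ : Subgroup (G × H)} (hΓ : BiInjective Γ) {p q : G × H}
    (hp : p ∈ Γ) (hq : q ∈ Γ) : p.1 = q.1 ↔ p.2 = q.2 := by
  have := hΓ _ (Γ.div_mem hp hq)
  rwa [Prod.fst_div, Prod.snd_div, div_eq_one, div_eq_one] at this

/-- The hypotheses say that `x` and `y` have the same order `n` modulo the two projections of `Γ`,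
with `n = 0` for infinite order. If a coordinate of `(a, b) * (x, y) ^ m` is trivial, then `n`
divides `m`, so the element already lies in `Γ`. -/
theorem BiInjective.sup_zpowers {Γ : Subgroup (G × H)} (hΓ : BiInjective Γ) {x : G} {y : H}
    {n : ℤ} (hn : (x ^ n, y ^ n) ∈ Γ)
    (hx : ∀ m : ℤ, (∃ b, (x ^ m, b) ∈ Γ) → n ∣ m) (hy : ∀ m : ℤ, (∃ a, (a, y ^ m) ∈ Γ) → n ∣ m) :
    BiInjective (Γ ⊔ Subgroup.zpowers (x, y)) := by
  intro p hp
  obtain ⟨⟨a, b⟩, hab, q, hq, rfl⟩ := Subgroup.mem_sup.1 hp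
  obtain ⟨m, rfl⟩ := Subgroup.mem_zpowers_iff.1 hq
  have key : n ∣ m → (a * x ^ m = 1 ↔ b * y ^ m = 1) := by
    rintro ⟨l, rfl⟩
    have := hΓ _ (Γ.mul_mem hab (Γ.zpow_mem hn l))
    simpa [zpow_mul] using this
  change a * x ^ m = 1 ↔ b * y ^ m = 1
  constructor
  · intro h
    refine (key (hx m ⟨b⁻¹, ?_⟩)).1 h
    rw [← inv_eq_of_mul_eq_one_right h]
    exact Γ.inv_mem hab
  · intro h
    refine (key (hy m ⟨a⁻¹, ?_⟩)).2 h
    rw [← inv_eq_of_mul_eq_one_right h]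
    exact Γ.inv_mem hab

theorem exists_maximal_biInjective (Γ₀ : Subgroup (G × H)) (h₀ : BiInjective Γ₀) :
    ∃ Γ, Γ₀ ≤ Γ ∧ Maximal BiInjective Γ := by
  refine zorn_le_nonempty₀ {Γ : Subgroup (G × H) | BiInjective Γ} ?_ Γ₀ h₀
  intro c hc hchain y hy
  refine ⟨sSup c, fun p hp => ?_, fun z hz => le_sSup hz⟩
  obtain ⟨Γ, hΓ, hp⟩ := (Subgroup.mem_sSup_of_directedOn ⟨y, hy⟩ hchain.directedOn).1 hp
  exact hc hΓ p hp

/-- By maximality, adjoining a pair of matching orders adds nothing, so the pair is already in `Γ`.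
In the applications this contradicts the assumption that `x` is outside the domain. -/
theorem Maximal.exists_of_sup {Γ : Subgroup (G × H)} (hΓ : Maximal BiInjective Γ) {x : G} {y : H}
    {n : ℤ} (hn : (x ^ n, y ^ n) ∈ Γ)
    (hx : ∀ m : ℤ, (∃ b, (x ^ m, b) ∈ Γ) → n ∣ m) (hy : ∀ m : ℤ, (∃ a, (a, y ^ m) ∈ Γ) → n ∣ m) :
    ∃ b, (x, b) ∈ Γ :=
  ⟨y, hΓ.2 (hΓ.1.sup_zpowers hn hx hy) le_sup_left
    (le_sup_right (a := Γ) (Subgroup.mem_zpowers (x, y)))⟩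

/-- The exponents `m` with `x ^ m ∈ S` form a subgroup of `ℤ` that contains `p` but not `1`. -/
theorem prime_dvd_of_zpow_mem {S : Subgroup G} {x : G} {p : ℕ} (hp : p.Prime)
    (h : x ^ p ∈ S) (hx : x ∉ S) {m : ℤ} (hm : x ^ m ∈ S) : (p : ℤ) ∣ m := by
  by_contra hd
  have hc : IsCoprime (p : ℤ) m := (Nat.prime_iff_prime_int.1 hp).coprime_iff_not_dvd.2 hd
  obtain ⟨a, b, hab⟩ := hc
  refine hx ?_
  have : x = (x ^ p) ^ a * (x ^ m) ^ b := by
    rw [← zpow_natCast, ← zpow_mul, ← zpow_mul, ← zpow_add, mul_comm (p : ℤ), mul_comm m, hab,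
      zpow_one]
  rw [this]
  exact S.mul_mem (S.zpow_mem h a) (S.zpow_mem hm b)

variable {K : Type v} [Field K] {L : Type w} [Field L] [IsAlgClosed L] [CharZero L]

/-- If `x` is outside the domain, no `p`-th root of `s` can be outside the range, since it could be
paired with `x`. So all roots are hit, and their preimages supply `K` with a primitive `p`-th root
of unity and with a `p`-th root of `x ^ p`. These generate every `p`-th root of `x ^ p` in `K`,
including `x`. -/
theorem Maximal.exists_of_prime_pow {Γ : Subgroup (Kˣ × Lˣ)} (hΓ : Maximal BiInjective Γ)
    {p : ℕ} (hp : p.Prime) {x : Kˣ} (hx : ∃ s, (x ^ p, s) ∈ Γ) : ∃ b, (x, b) ∈ Γ := by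
  by_contra hx'
  obtain ⟨s, hs⟩ := hx
  have hmap : ∀ z, z ∈ Γ.map (MonoidHom.fst Kˣ Lˣ) ↔ ∃ b, (z, b) ∈ Γ := fun z => by
    simp [Subgroup.mem_map]
  have hmap' : ∀ z, z ∈ Γ.map (MonoidHom.snd Kˣ Lˣ) ↔ ∃ a, (a, z) ∈ Γ := fun z => by
    simp [Subgroup.mem_map]
  -- a `p`-th root of `s` outside the range yields an extension of `Γ`
  have key : ∀ y : Lˣ, y ^ p = s → ∃ a, (a, y) ∈ Γ := by
    intro y hy
    by_contra hy'
    refine hx' (Maximal.exists_of_sup hΓ (n := p) (y := y) ?_ ?_ ?_)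
    · rwa [zpow_natCast, zpow_natCast, hy]
    · intro m hm
      rw [← hmap] at hx' hm
      exact prime_dvd_of_zpow_mem hp ((hmap _).2 ⟨s, hs⟩) hx' hm
    · intro m hm
      rw [← hmap'] at hy' hm
      exact prime_dvd_of_zpow_mem hp ((hmap' _).2 ⟨x ^ p, by rwa [hy]⟩) hy' hm
  obtain ⟨y', hy'⟩ := IsAlgClosed.exists_pow_nat_eq (s : L) hp.pos
  have hy0 : y' ≠ 0 := by
    rintro rfl
    rw [zero_pow hp.ne_zero] at hy'
    exact s.ne_zero hy'.symm
  obtain ⟨y, rfl⟩ : ∃ y : Lˣ, (y : L) = y' := ⟨Units.mk0 y' hy0, rfl⟩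
  have hy : y ^ p = s := Units.ext (by simpa using hy')
  obtain ⟨z, hz⟩ := key y hy
  -- Characteristic zero of `L` is essential here: it provides a second root `y * ζ` for every prime
  -- `p`.
  have : NeZero (p : L) := ⟨Nat.cast_ne_zero.2 hp.ne_zero⟩
  obtain ⟨ζ', hζ'⟩ := HasEnoughRootsOfUnity.exists_primitiveRoot L p
  obtain ⟨ζ, rfl⟩ : ∃ ζ : Lˣ, (ζ : L) = ζ' := ⟨(hζ'.isUnit hp.ne_zero).unit, rfl⟩
  have hζ : ζ ^ p = 1 := Units.ext (by simpa using hζ'.pow_eq_one)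
  have hζ1 : ζ ≠ 1 := by
    rintro rfl
    exact hζ'.ne_one hp.one_lt rfl
  obtain ⟨w, hw⟩ := key (y * ζ) (by rw [mul_pow, hζ, mul_one, hy])
  have hε : (w / z, ζ) ∈ Γ := by simpa using Γ.div_mem hw hz
  have hεp : (w / z) ^ p = 1 := (hΓ.1 _ (Γ.pow_mem hε p)).2 hζ
  have hε1 : w / z ≠ 1 := fun h => hζ1 ((hΓ.1 _ hε).1 h)
  have hδ : (x / z) ^ p = 1 := by
    rw [div_pow, div_eq_one]
    exact (hΓ.1.fst_eq_iff hs (Γ.pow_mem hz p)).2 hy.symm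
  have : Fact p.Prime := ⟨hp⟩
  have hor : orderOf (w / z) = p := orderOf_eq_prime_iff.2 ⟨hεp, hε1⟩
  have hprim : IsPrimitiveRoot ((w / z : Kˣ) : K) p :=
    IsPrimitiveRoot.coe_units_iff.2
      (hor ▸ IsPrimitiveRoot.orderOf (w / z))
  have : NeZero p := ⟨hp.ne_zero⟩
  -- In a field the `p`-th roots of unity are the powers of a primitive one, so `x / z` is a power
  -- of `w / z`, which is paired with `ζ`.
  obtain ⟨n, -, hn⟩ := hprim.eq_pow_of_pow_eq_one (ξ := ((x / z : Kˣ) : K))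
    (by rw [← Units.val_pow_eq_pow_val, hδ, Units.val_one])
  have hn : (w / z) ^ n = x / z := Units.ext (by simpa using hn)
  refine hx' ⟨ζ ^ n * y, ?_⟩
  have := Γ.mul_mem (Γ.pow_mem hε n) hz
  rwa [Prod.pow_mk, Prod.mk_mul_mk, hn, div_mul_cancel] at this

theorem Maximal.exists_of_pow {Γ : Subgroup (Kˣ × Lˣ)} (hΓ : Maximal BiInjective Γ)
    {n : ℕ} (hn : n ≠ 0) : ∀ {x : Kˣ}, (∃ s, (x ^ n, s) ∈ Γ) → ∃ b, (x, b) ∈ Γ := by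
  induction n using induction_on_primes with
  | zero => exact absurd rfl hn
  | one => exact fun h => by simpa using h
  | prime_mul p a hp ih =>
    intro x hx
    rw [pow_mul] at hx
    exact Maximal.exists_of_prime_pow hΓ hp (ih (right_ne_zero_of_mul hn) hx)

/-- An `x` outside the domain has infinite order modulo it, because the domain is closed under
roots. It can therefore be paired with any element of infinite order modulo the range, and the
family `v` is large enough to contain one. -/
theorem Maximal.exists_mem {Γ : Subgroup (Kˣ × Lˣ)} (hΓ : Maximal BiInjective Γ)
    (v : Set (ℕ × Kˣ) → Lˣ) (hv : ∀ n ≠ 0, Function.Injective fun s => v s ^ n) (x : Kˣ) :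
    ∃ b, (x, b) ∈ Γ := by
  by_contra hx
  -- Otherwise each `s` has a nonzero power `v s ^ n s` in the range, with preimage `a s`. The pair
  -- `(n s, a s)` determines `s`, which would inject the power set of `ℕ × Kˣ` into `ℕ × Kˣ`.
  obtain ⟨s, hs⟩ : ∃ s, ∀ n : ℕ, n ≠ 0 → ¬ ∃ a, (a, v s ^ n) ∈ Γ := by
    by_contra! h
    choose n hn a ha using h
    refine Function.cantor_injective (fun s => (n s, a s)) fun s t hst => ?_
    obtain ⟨h1, h2⟩ := Prod.mk.inj hst
    refine hv (n s) (hn s) ?_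
    have := (hΓ.1.fst_eq_iff (ha s) (ha t)).1 h2
    simpa only [h1] using this
  refine hx (Maximal.exists_of_sup hΓ (n := 0) (y := v s) ?_ ?_ ?_)
  · rw [zpow_zero, zpow_zero]
    exact Γ.one_mem
  · rintro m ⟨b, hb⟩
    by_contra hm
    refine hx (Maximal.exists_of_pow hΓ (n := m.natAbs) (by simpa using hm) ?_)
    rcases Int.natAbs_eq m with h | h
    · exact ⟨b, by rwa [← zpow_natCast, ← h]⟩
    · exact ⟨b⁻¹, by rw [← zpow_natCast, ← neg_eq_iff_eq_neg.2 h, zpow_neg]; exact Γ.inv_mem hb⟩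
  · rintro m ⟨a, ha⟩
    by_contra hm
    refine hs m.natAbs (by simpa using hm) ?_
    rcases Int.natAbs_eq m with h | h
    · exact ⟨a, by rwa [← zpow_natCast, ← h]⟩
    · exact ⟨a⁻¹, by rw [← zpow_natCast, ← neg_eq_iff_eq_neg.2 h, zpow_neg]; exact Γ.inv_mem ha⟩

/-- A bi-injective subgroup of `Kˣ × Lˣ` extends to an embedding `K → L` of pointed monoids if `L`
is algebraically closed of characteristic zero and sufficiently large. -/
theorem BiInjective.exists_embedding {Γ₀ : Subgroup (Kˣ × Lˣ)} (h₀ : BiInjective Γ₀)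
    (v : Set (ℕ × Kˣ) → Lˣ) (hv : ∀ n ≠ 0, Function.Injective fun s => v s ^ n) :
    ∃ σ : K →*₀ L, Function.Injective σ ∧ ∀ (x : Kˣ) (y : Lˣ), (x, y) ∈ Γ₀ → σ x = y := by
  classical
  obtain ⟨Γ, hle, hΓ⟩ := exists_maximal_biInjective Γ₀ h₀
  choose τ hτ using Maximal.exists_mem hΓ v hv
  have hτ' : ∀ {x y}, (x, y) ∈ Γ → τ x = y := fun {x y} h =>
    (hΓ.1.fst_eq_iff (hτ x) h).1 rfl
  refine ⟨⟨⟨fun a => if h : a = 0 then 0 else (τ (Units.mk0 a h) : L), by simp⟩, ?_, ?_⟩, ?_, ?_⟩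
  · have : τ 1 = 1 := hτ' Γ.one_mem
    simp [this]
  · intro a b
    by_cases ha : a = 0
    · simp [ha]
    by_cases hb : b = 0
    · simp [hb]
    have : τ (Units.mk0 a ha * Units.mk0 b hb) = τ (Units.mk0 a ha) * τ (Units.mk0 b hb) :=
      hτ' (Γ.mul_mem (hτ _) (hτ _))
    simp [ha, hb, this]
  · intro a b hab
    change (if h : a = 0 then (0 : L) else (τ (Units.mk0 a h) : L)) =
      if h : b = 0 then (0 : L) else (τ (Units.mk0 b h) : L) at hab
    by_cases ha : a = 0
    · by_cases hb : b = 0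
      · rw [ha, hb]
      · simp only [ha, hb, dite_true, dite_false] at hab
        exact absurd hab.symm (Units.ne_zero _)
    · by_cases hb : b = 0
      · simp [ha, hb] at hab
      · simp only [ha, hb, dite_false, Units.val_inj] at hab
        have := (hΓ.1.fst_eq_iff (hτ (Units.mk0 a ha)) (hτ (Units.mk0 b hb))).2 hab
        simpa using congrArg Units.val this
  · intro x y hxy
    change (if h : (x : K) = 0 then (0 : L) else (τ (Units.mk0 x h) : L)) = y
    rw [dif_neg x.ne_zero, Units.mk0_val, hτ' (hle hxy)]

theorem exists_embedding_comp_eq {k : Type u} [CommMonoidWithZero k] (j : k →*₀ K)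
    (hj : Function.Injective j) (i : k →*₀ L) (hi : Function.Injective i)
    (v : Set (ℕ × Kˣ) → Lˣ) (hv : ∀ n ≠ 0, Function.Injective fun s => v s ^ n) :
    ∃ σ : K →*₀ L, Function.Injective σ ∧ ∀ c, σ (j c) = i c := by
  have hj0 : ∀ {c}, c ≠ 0 → j c ≠ 0 := fun {c} hc => (map_ne_zero_iff j hj).2 hc
  have hi0 : ∀ {c}, c ≠ 0 → i c ≠ 0 := fun {c} hc => (map_ne_zero_iff i hi).2 hc
  have hmul : ∀ {a b : k}, a ≠ 0 → b ≠ 0 → a * b ≠ 0 := fun {a b} ha hb h =>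
    mul_ne_zero (hj0 ha) (hj0 hb) (by rw [← map_mul, h, map_zero])
  -- The pairs `(j a / j b, i a / i b)` with denominators cleared. Either coordinate is `1` exactly
  -- when `a = b`.
  let Γ : Subgroup (Kˣ × Lˣ) :=
    { carrier := {p | ∃ a b : k, a ≠ 0 ∧ b ≠ 0 ∧ (p.1 : K) * j b = j a ∧ (p.2 : L) * i b = i a}
      one_mem' := ⟨1, 1, fun h => one_ne_zero (by rw [← map_one j, h, map_zero]),
        fun h => one_ne_zero (by rw [← map_one j, h, map_zero]), by simp, by simp⟩
      mul_mem' := by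
        rintro ⟨x, y⟩ ⟨x', y'⟩ ⟨a, b, ha, hb, h1, h2⟩ ⟨a', b', ha', hb', h1', h2'⟩
        refine ⟨a * a', b * b', hmul ha ha', hmul hb hb', ?_, ?_⟩
        · rw [map_mul, map_mul, ← h1, ← h1']; push_cast; exact mul_mul_mul_comm _ _ _ _
        · rw [map_mul, map_mul, ← h2, ← h2']; push_cast; exact mul_mul_mul_comm _ _ _ _
      inv_mem' := by
        rintro ⟨x, y⟩ ⟨a, b, ha, hb, h1, h2⟩
        refine ⟨b, a, hb, ha, ?_, ?_⟩
        · rw [← h1]; simp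
        · rw [← h2]; simp }
  have hΓ : BiInjective Γ := by
    rintro ⟨x, y⟩ ⟨a, b, ha, hb, h1, h2⟩
    dsimp only at h1 h2 ⊢
    have e1 : x = 1 ↔ a = b := by
      constructor
      · rintro rfl
        exact hj (by simpa using h1.symm)
      · rintro rfl
        exact Units.ext (mul_right_cancel₀ (hj0 ha) (by simpa using h1))
    have e2 : y = 1 ↔ a = b := by
      constructor
      · rintro rfl
        exact hi (by simpa using h2.symm)
      · rintro rfl
        exact Units.ext (mul_right_cancel₀ (hi0 ha) (by simpa using h2))
    rw [e1, e2]
  obtain ⟨σ, hσ, h⟩ := hΓ.exists_embedding v hv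
  refine ⟨σ, hσ, fun c => ?_⟩
  by_cases hc : c = 0
  · rw [hc, map_zero, map_zero, map_zero]
  · exact h (Units.mk0 _ (hj0 hc)) (Units.mk0 _ (hi0 hc))
      ⟨c, 1, hc, fun h => one_ne_zero (by rw [← map_one j, h, map_zero]), by simp, by simp⟩

/-- Every field of characteristic zero has an algebraically closed extension with a family of
elements, indexed by a given type, whose powers are pairwise distinct. -/
theorem exists_algClosed_extension (F : Type w) [Field F] [CharZero F] (I : Type v) :
    ∃ (L : Type (max v w)) (_ : Field L) (_ : IsAlgClosed L) (_ : CharZero L) (_ : F →+* L)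
      (v : I → Lˣ), ∀ n ≠ 0, Function.Injective fun s => v s ^ n := by
  -- The family consists of independent variables, whose equal nonzero powers are distinct
  -- monomials.
  let P := MvPolynomial I F
  let Q := FractionRing P
  let ψ : P →+* AlgebraicClosure Q := (algebraMap Q (AlgebraicClosure Q)).comp (algebraMap P Q)
  have hψ : Function.Injective ψ :=
    (algebraMap Q (AlgebraicClosure Q)).injective.comp (IsFractionRing.injective P Q)
  let φ : F →+* AlgebraicClosure Q := ψ.comp MvPolynomial.C
  have : CharZero (AlgebraicClosure Q) := charZero_of_injective_ringHom φ.injective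
  refine ⟨AlgebraicClosure Q, inferInstance, inferInstance, inferInstance, φ,
    fun s => Units.mk0 (ψ (MvPolynomial.X s)) ?_, ?_⟩
  · rw [Ne, map_eq_zero_iff ψ hψ]
    exact MvPolynomial.X_ne_zero s
  · intro n hn s t hst
    have h : ψ (MvPolynomial.X s ^ n) = ψ (MvPolynomial.X t ^ n) := by
      simpa using congrArg Units.val hst
    have h := hψ h
    rw [MvPolynomial.X_pow_eq_monomial, MvPolynomial.X_pow_eq_monomial,
      MvPolynomial.monomial_left_inj one_ne_zero] at h
    exact (Finsupp.single_left_inj hn).1 h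

/-- Every pointed domain embeds into a field of characteristic zero. -/
theorem IsPointedDomain.exists_charZero {k : Type u} [CommMonoidWithZero k]
    (hk : IsPointedDomain k) :
    ∃ (F : Type u) (_ : Field F) (i : k →*₀ F), CharZero F ∧ Function.Injective i := by
  obtain ⟨K, _, j, hj⟩ := hk
  obtain ⟨L, _, _, _, -, v, hv⟩ := exists_algClosed_extension ℚ (Set (ℕ × Kˣ))
  -- No compatibility is required, so the amalgamation starts from the trivial subgroup.
  obtain ⟨σ, hσ, -⟩ := BiInjective.exists_embedding (K := K) (L := L) (Γ₀ := ⊥)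
    (by rintro p rfl; simp) v hv
  exact ⟨L, inferInstance, σ.comp j, inferInstance, hσ.comp hj⟩

end Amalgamation

/-! ## The affine case -/

section Affine

/-- A pointed monoid that embeds into an integral domain, in any universe, is a domain. -/
theorem isPointedDomain_of_injective {A : Type v} [CommMonoidWithZero A] {K : Type w} [CommRing K]
    [IsDomain K] (i : A →*₀ K) (hi : Function.Injective i) : IsPointedDomain A := by
  -- `IsPointedDomain` asks for a field in the universe of `A`. The subring of `K` generated by `A`,
  -- presented as a quotient of `ℤ[A]`, has its fraction field there.
  let φ : MonoidAlgebra ℤ A →+* K := (MonoidAlgebra.lift ℤ K A (i : A →* K)).toRingHom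
  have hφ : ∀ a, φ (MonoidAlgebra.of ℤ A a) = i a := fun a =>
    MonoidAlgebra.lift_of (R := ℤ) (i : A →* K) a
  have : (RingHom.ker φ).IsPrime := RingHom.ker_isPrime φ
  let D := MonoidAlgebra ℤ A ⧸ RingHom.ker φ
  let j : A →*₀ FractionRing D :=
    { toFun a := algebraMap D _ (Ideal.Quotient.mk _ (MonoidAlgebra.of ℤ A a))
      map_zero' := by
        rw [Ideal.Quotient.eq_zero_iff_mem.2, map_zero]
        rw [RingHom.mem_ker, hφ, map_zero]
      map_one' := by simp only [map_one]
      map_mul' a b := by simp only [map_mul] }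
  refine ⟨FractionRing D, inferInstance, j, fun a b hab => ?_⟩
  have : Ideal.Quotient.mk (RingHom.ker φ) (MonoidAlgebra.of ℤ A a) =
      Ideal.Quotient.mk (RingHom.ker φ) (MonoidAlgebra.of ℤ A b) :=
    IsFractionRing.injective D (FractionRing D) hab
  rw [Ideal.Quotient.eq, RingHom.mem_ker, map_sub, hφ, hφ, sub_eq_zero] at this
  exact hi this

theorem isOpen_basicOpen {A : Type u} [CommMonoidWithZero A] (a b : A) :
    IsOpen (Cong.basicOpen a b) := isOpen_generateFrom_of_mem ⟨a, b, rfl⟩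

instance {A : Type u} [CommMonoidWithZero A] : T0Space (Cong A) := by
  refine ⟨fun c d h => Subtype.ext (Con.ext fun a b => ?_)⟩
  have := h.mem_open_iff (isOpen_basicOpen a b)
  exact not_iff_not.1 this

/-- Existence of generic points is quasi-sobriety; uniqueness, tested on closures of points, is the
`T0` axiom. -/
theorem isSober_iff {T : Type u} [TopologicalSpace T] : IsSober T ↔ QuasiSober T ∧ T0Space T := by
  constructor
  · intro h
    refine ⟨⟨fun {S} hS hS' => (h S hS hS').exists⟩, ⟨fun x y hxy => ?_⟩⟩
    refine (h (closure {x}) isIrreducible_singleton.closure isClosed_closure).unique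
      isGenericPoint_closure ?_
    rw [inseparable_iff_closure_eq.1 hxy]
    exact isGenericPoint_closure
  · rintro ⟨_, _⟩ Z hZ hZ'
    obtain ⟨x, hx⟩ := QuasiSober.sober hZ hZ'
    exact ⟨x, hx, fun y hy => hy.eq hx⟩

/-- The continuous image of a Noetherian sober space is quasi-sober. -/
theorem quasiSober_of_surjective {X : Type u} {Y : Type v} [TopologicalSpace X]
    [TopologicalSpace Y] [NoetherianSpace X] [QuasiSober X] (π : X → Y) (hπ : Continuous π)
    (hs : Function.Surjective π) : QuasiSober Y := by
  refine ⟨fun {Z} hZ hZc => ?_⟩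
  -- The preimage of `Z` has finitely many irreducible pieces. As `Z` is irreducible, the image of
  -- one of them is dense in `Z`, and the generic point of that piece maps to a generic point of
  -- `Z`.
  obtain ⟨S, hSf, hS, hSi, hZS⟩ := NoetherianSpace.exists_finite_set_isClosed_irreducible
    (hZc.preimage hπ)
  have hsub : Z ⊆ ⋃₀ ((fun T => closure (π '' T)) '' S) := by
    intro z hz
    obtain ⟨x, rfl⟩ := hs z
    have hx : x ∈ π ⁻¹' Z := hz
    rw [hZS] at hx
    obtain ⟨T, hT, hx⟩ := hx
    exact ⟨_, ⟨T, hT, rfl⟩, subset_closure ⟨x, hx, rfl⟩⟩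
  obtain ⟨_, ⟨T, hT, rfl⟩, hZT⟩ := isIrreducible_iff_sUnion_isClosed.1 hZ
    (hSf.image (fun T => closure (π '' T))).toFinset
    (by simp) (by simpa using hsub) |>.imp fun T hT => by simpa using hT
  obtain ⟨x, hx⟩ := QuasiSober.sober (hSi T hT) (hS T hT)
  refine ⟨π x, ?_⟩
  have h := hx.image hπ
  have : closure (π '' T) = Z := by
    refine (closure_minimal ?_ hZc).antisymm hZT
    rw [Set.image_subset_iff, hZS]
    exact Set.subset_sUnion_of_mem hT
  rwa [this] at h

variable {k : Type u} [CommMonoidWithZero k] {B : Type v} [CommMonoidWithZero B]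
  {F : Type w} [Field F]

theorem toRelRing_map (f : k →*₀ B) (i : k →*₀ F) (c : k) :
    toRelRing f i (f c) = algebraMap F (RelRing f i) (i c) := by
  have h : MonoidAlgebra.single (1 : B) (i c) - MonoidAlgebra.single (f c) (1 : F) ∈
      relIdeal f i := Ideal.subset_span ⟨c, rfl⟩
  exact ((Ideal.Quotient.eq).2 h).symm

/-- The coefficients from `k` become scalars of `F` in `R`, so polynomials in the classes of the
`b_j` exhaust `R`. -/
theorem isNoetherianRing_relRing {f : k →*₀ B} (hf : IsFinitelyGenerated f) (i : k →*₀ F) :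
    IsNoetherianRing (RelRing f i) := by
  obtain ⟨n, b, hb⟩ := hf
  let ψ : MvPolynomial (Fin n) F →ₐ[F] RelRing f i :=
    MvPolynomial.aeval fun j => toRelRing f i (b j)
  have hof : ∀ x : B, toRelRing f i x ∈ ψ.range := by
    intro x
    obtain ⟨c, m, rfl⟩ := hb x
    rw [map_mul, map_prod, toRelRing_map]
    refine mul_mem (Subalgebra.algebraMap_mem _ _) (prod_mem fun j _ => ?_)
    rw [map_pow]
    exact pow_mem (ψ.mem_range.2 ⟨MvPolynomial.X j, MvPolynomial.aeval_X _ _⟩) _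
  refine isNoetherianRing_of_surjective _ _ ψ.toRingHom fun x => ?_
  obtain ⟨y, rfl⟩ := Ideal.Quotient.mk_surjective x
  change Ideal.Quotient.mk (relIdeal f i) y ∈ ψ.range
  induction y using MonoidAlgebra.induction_on with
  | of x => exact hof x
  | add x y hx hy => rw [map_add]; exact add_mem hx hy
  | smul r x hx => exact ψ.range.smul_mem hx r

theorem specToCong_iff {R : Type w} [CommRing R] (φ : B →*₀ R) (p : PrimeSpectrum R) (a b : B) :
    (specToCong φ p).1 a b ↔ φ a - φ b ∈ p.asIdeal := Ideal.Quotient.eq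

theorem continuous_specToCong {R : Type w} [CommRing R] (φ : B →*₀ R) :
    Continuous (specToCong φ) := by
  refine continuous_generateFrom_iff.2 ?_
  rintro _ ⟨a, b, rfl⟩
  convert (PrimeSpectrum.basicOpen (φ a - φ b)).isOpen using 1
  ext p
  exact not_congr (specToCong_iff φ p a b)

theorem isPointedDomain_specToCong {R : Type w} [CommRing R] (φ : B →*₀ R)
    (p : PrimeSpectrum R) : IsPointedDomain (specToCong φ p).1.Quotient := by
  let j : (Con.ker (toResidue φ p)).Quotient →*₀ R ⧸ p.asIdeal :=
    { Con.kerLift ((toResidue φ p : B →*₀ R ⧸ p.asIdeal) : B →* R ⧸ p.asIdeal) with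
      map_zero' := map_zero (toResidue φ p) }
  exact isPointedDomain_of_injective j
    (Con.kerLift_injective ((toResidue φ p : B →*₀ R ⧸ p.asIdeal) : B →* R ⧸ p.asIdeal))

/-- For distinct elements of `k`, the difference of their images in `F` is a unit and cannot lie in
a prime ideal of `R`. -/
theorem specToCong_mem (f : k →*₀ B) (i : k →*₀ F) (hi : Function.Injective i)
    (p : PrimeSpectrum (RelRing f i)) : specToCong (toRelRing f i) p ∈ SCong f := by
  constructor
  · exact isPointedDomain_specToCong (toRelRing f i) p
  · intro a b hab
    have h := (specToCong_iff (toRelRing f i) p _ _).1 ((Con.eq _).1 hab)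
    rw [toRelRing_map, toRelRing_map, ← map_sub] at h
    by_contra hne
    have hu : IsUnit (i a - i b) := (sub_ne_zero.2 fun h => hne (hi h)).isUnit
    exact p.2.ne_top (Ideal.eq_top_of_isUnit_mem _ h (hu.map _))

theorem SCong.subset_range_specToCong [CharZero F] (f : k →*₀ B) (i : k →*₀ F)
    (hi : Function.Injective i) : SCong f ⊆ Set.range (specToCong (toRelRing f i)) := by
  rintro c ⟨⟨K, _, j, hj⟩, hc⟩
  obtain ⟨L, _, _, _, φ, v, hv⟩ := exists_algClosed_extension F (Set (ℕ × Kˣ))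
  obtain ⟨σ, hσ, hσj⟩ := exists_embedding_comp_eq (j.comp ((proj c.1).comp f)) (hj.comp hc)
    (φ.toMonoidWithZeroHom.comp i) (φ.injective.comp hi) v hv
  let β : B →*₀ L := σ.comp (j.comp (proj c.1))
  have hβ : ∀ a b, β a = β b ↔ c.1 a b := fun a b =>
    (hσ.comp hj).eq_iff.trans (Con.eq c.1)
  let := φ.toAlgebra
  let Ψ : MonoidAlgebra F B →+* L := (MonoidAlgebra.lift F L B (β : B →* L)).toRingHom
  have hΨ : ∀ b r, Ψ (MonoidAlgebra.single b r) = φ r * β b := fun b r =>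
    (MonoidAlgebra.lift_single (β : B →* L) b r).trans (Algebra.smul_def _ _)
  let Φ : RelRing f i →+* L := Ideal.Quotient.lift (relIdeal f i) Ψ (by
    intro x hx
    suffices relIdeal f i ≤ RingHom.ker Ψ from this hx
    refine Ideal.span_le.2 ?_
    rintro _ ⟨a, rfl⟩
    change Ψ _ = 0
    rw [map_sub, hΨ, hΨ, map_one, map_one, mul_one, one_mul, sub_eq_zero]
    exact (hσj a).symm)
  have hΦ : ∀ b, Φ (toRelRing f i b) = β b := fun b => by
    change Ψ (MonoidAlgebra.single b 1) = _
    rw [hΨ, map_one, one_mul]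
  refine ⟨⟨RingHom.ker Φ, RingHom.ker_isPrime Φ⟩, Subtype.ext (Con.ext fun a b => ?_)⟩
  rw [specToCong_iff, RingHom.mem_ker, map_sub, hΦ, hΦ, sub_eq_zero, hβ]

theorem SCong.quasiSober (hk : IsPointedDomain k) (f : k →*₀ B) (hf : IsFinitelyGenerated f) :
    QuasiSober (SCong f) := by
  obtain ⟨F, _, i, _, hi⟩ := hk.exists_charZero
  have := isNoetherianRing_relRing hf i
  refine quasiSober_of_surjective
    (fun p => (⟨specToCong (toRelRing f i) p, specToCong_mem f i hi p⟩ : SCong f))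
    ((continuous_specToCong _).subtype_mk _) fun c => ?_
  obtain ⟨p, hp⟩ := SCong.subset_range_specToCong f i hi c.2
  exact ⟨p, Subtype.ext hp⟩

end Affine

/-! ## Localization at one element -/

section Away

variable {k : Type u} [CommMonoidWithZero k] {A : Type v} [CommMonoidWithZero A]
  {A' : Type v} [CommMonoidWithZero A']

/-- A morphism of pointed monoids that exhibits the target as the localization of the source at
the powers of `h`. -/
def IsAway (h : A) (g : A →*₀ A') : Prop := Submonoid.IsLocalizationMap (Submonoid.powers h) g

theorem IsAway.isUnit {h : A} {g : A →*₀ A'} (hg : IsAway h g) : IsUnit (g h) :=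
  hg.map_units ⟨h, Submonoid.mem_powers h⟩

theorem IsAway.surj {h : A} {g : A →*₀ A'} (hg : IsAway h g) (x : A') :
    ∃ (a : A) (n : ℕ), x * g h ^ n = g a := by
  obtain ⟨⟨a, _, n, rfl⟩, hx⟩ := Submonoid.IsLocalizationMap.surj hg x
  exact ⟨a, n, by simpa using hx⟩

theorem IsAway.exists_of_eq {h : A} {g : A →*₀ A'} (hg : IsAway h g) {a b : A} (hab : g a = g b) :
    ∃ n : ℕ, h ^ n * a = h ^ n * b := by
  obtain ⟨⟨_, n, rfl⟩, hx⟩ := Submonoid.IsLocalizationMap.exists_of_eq hg hab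
  exact ⟨n, hx⟩

theorem isAway_iff {h : A} {g : A →*₀ A'} : IsAway h g ↔ IsUnit (g h) ∧
    (∀ x : A', ∃ (a : A) (n : ℕ), x * g h ^ n = g a) ∧
    ∀ a b : A, g a = g b → ∃ n : ℕ, h ^ n * a = h ^ n * b := by
  refine ⟨fun hg => ⟨hg.isUnit, hg.surj, fun _ _ => hg.exists_of_eq⟩, fun ⟨h1, h2, h3⟩ => ⟨?_, ?_, ?_⟩⟩
  · rintro ⟨_, n, rfl⟩
    simpa using h1.pow n
  · intro x
    obtain ⟨a, n, hx⟩ := h2 x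
    exact ⟨⟨a, _, n, rfl⟩, by simpa using hx⟩
  · intro a b hab
    obtain ⟨n, hn⟩ := h3 a b hab
    exact ⟨⟨_, n, rfl⟩, hn⟩

theorem IsFinitelyGenerated.comp_of_isAway {f : k →*₀ A} (hf : IsFinitelyGenerated f) {h : A}
    {g : A →*₀ A'} (hg : IsAway h g) : IsFinitelyGenerated (g.comp f) := by
  obtain ⟨n, b, hb⟩ := hf
  obtain ⟨u, hu⟩ := hg.isUnit
  -- The additional generator is the inverse of `g h`, with exponent the power of `h` in the
  -- denominator.
  refine ⟨n + 1, Fin.cons (↑u⁻¹ : A') fun i => g (b i), fun x => ?_⟩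
  obtain ⟨a, l, hx⟩ := hg.surj x
  obtain ⟨c, m, rfl⟩ := hb a
  refine ⟨c, Fin.cons l m, ?_⟩
  rw [← hu, ← Units.val_pow_eq_pow_val, ← Units.eq_mul_inv_iff_mul_eq] at hx
  rw [hx, Fin.prod_univ_succ]
  simp only [map_mul, map_prod, map_pow, Fin.cons_zero, Fin.cons_succ, MonoidWithZeroHom.comp_apply,
    inv_pow, ← Units.val_pow_eq_pow_val]
  rw [mul_assoc, mul_comm (∏ i, g (b i) ^ m i)]

/-- The congruence kernel of a morphism to a field, as a prime congruence. -/
def Cong.ker {K : Type w} [Field K] (ψ : A →*₀ K) : Cong A :=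
  ⟨Con.ker ψ, isPrimeCon_of_injective _
    { Con.kerLift (ψ : A →* K) with map_zero' := map_zero ψ }
    (Con.kerLift_injective (ψ : A →* K)) ⟨inferInstance, fun _ _ _ h => (mul_eq_mul_left_iff.1 h).symm⟩⟩

theorem Cong.isPointedDomain_ker {K : Type v} [Field K] (ψ : A →*₀ K) :
    IsPointedDomain (Cong.ker ψ).1.Quotient :=
  ⟨K, inferInstance, { Con.kerLift (ψ : A →* K) with map_zero' := map_zero ψ },
    Con.kerLift_injective (ψ : A →* K)⟩

theorem Cong.not_of_isUnit (c : Cong A) {a : A} (ha : IsUnit a) : ¬ c.1 a 0 := by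
  intro h
  obtain ⟨b, hb⟩ := ha.exists_left_inv
  have h := c.1.mul (c.1.refl b) h
  rw [hb, mul_zero] at h
  have := c.2.1
  exact one_ne_zero (α := c.1.Quotient) ((Con.eq _).2 h)

theorem Cong.mul_zero_iff (c : Cong A) (a b : A) : c.1 (a * b) 0 ↔ c.1 a 0 ∨ c.1 b 0 := by
  constructor
  · intro h
    have : (a : c.1.Quotient) * (b : c.1.Quotient) = (a : c.1.Quotient) * (0 : c.1.Quotient) := by
      rw [mul_zero]
      exact (Con.eq _).2 h
    exact (c.2.2 _ _ _ this).imp (Con.eq _).1 (Con.eq _).1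
  · rintro (h | h)
    · simpa using c.1.mul h (c.1.refl b)
    · simpa using c.1.mul (c.1.refl a) h

theorem Cong.isInducing_pullback {h : A} {g : A →*₀ A'} (hg : IsAway h g) :
    Topology.IsInducing (Cong.pullback g) := by
  refine ⟨le_antisymm (continuous_iff_le_induced.1 (Cong.continuous_pullback g)) ?_⟩
  refine le_generateFrom ?_
  rintro _ ⟨a', b', rfl⟩
  obtain ⟨a, n, ha⟩ := hg.surj a'
  obtain ⟨b, m, hb⟩ := hg.surj b'
  -- Cross-multiplication: `a / h ^ n` and `b / h ^ m` are congruent exactly when `a h ^ m` and `b h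
  -- ^ n` are, as `h` is invertible in `A'`.
  refine isOpen_induced_iff.2 ⟨_, isOpen_basicOpen (a * h ^ m) (b * h ^ n), ?_⟩
  have ea : g (a * h ^ m) = a' * (g h ^ n * g h ^ m) := by
    rw [map_mul, map_pow, ← ha, mul_assoc]
  have eb : g (b * h ^ n) = b' * (g h ^ n * g h ^ m) := by
    rw [map_mul, map_pow, ← hb, mul_assoc, mul_comm (g h ^ m)]
  ext d
  change ¬ d.1 (g (a * h ^ m)) (g (b * h ^ n)) ↔ ¬ d.1 a' b'
  rw [ea, eb]
  refine not_congr ⟨fun h => ?_, fun h => d.1.mul h (d.1.refl _)⟩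
  obtain ⟨u, hu⟩ := ((hg.isUnit.pow n).mul (hg.isUnit.pow m)).exists_right_inv
  have := d.1.mul h (d.1.refl u)
  rwa [mul_assoc a', mul_assoc b', hu, mul_one, mul_one] at this

variable (f : k →*₀ A) (g : A →*₀ A') (f' : k →*₀ A') (hgf : g.comp f = f')

theorem SCong.isEmbedding_map {h : A} (hg : IsAway h g) :
    Topology.IsEmbedding (SCong.map f g f' hgf) := by
  have : Topology.IsInducing (SCong.map f g f' hgf) :=
    .of_comp (SCong.map f g f' hgf).continuous continuous_subtype_val
      ((Cong.isInducing_pullback hg).comp Topology.IsInducing.subtypeVal)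
  -- An inducing map from a `T0` space is injective.
  exact ⟨this, this.injective⟩

/-- If `h` is not congruent to `0`, it becomes a unit in any field containing the quotient, so the
map to that field extends to the localization, and the kernel of the extension restricts to `c`. -/
theorem SCong.range_map {h : A} (hg : IsAway h g) :
    Set.range (SCong.map f g f' hgf) = {c | ¬ c.1.1 h 0} := by
  ext c
  constructor
  · rintro ⟨d, rfl⟩ hc
    have hc : d.1.1 (g h) (g 0) := hc
    rw [map_zero] at hc
    exact d.1.not_of_isUnit hg.isUnit hc
  · intro hc
    subst hgf
    obtain ⟨⟨c, hc'⟩, ⟨K, _, i, hi⟩, hinj⟩ := c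
    let ψ : A →*₀ K := i.comp (proj c)
    have hψ : ∀ a b, ψ a = ψ b ↔ c a b := fun a b => hi.eq_iff.trans (Con.eq c)
    have hψh : IsUnit (ψ h) := by
      rw [isUnit_iff_ne_zero, ← map_zero ψ, Ne, hψ]
      exact hc
    let L : Submonoid.LocalizationMap (Submonoid.powers h) A' := ⟨(g : A →* A'), hg⟩
    have hL : ∀ y : Submonoid.powers h, IsUnit (ψ y) := by
      rintro ⟨_, n, rfl⟩
      simpa using hψh.pow n
    let ψ' : A' →*₀ K := L.lift₀ ψ hL
    have hψ' : ∀ a, ψ' (g a) = ψ a := fun a => L.lift_eq (g := (ψ : A →* K)) hL a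
    refine ⟨⟨Cong.ker ψ', Cong.isPointedDomain_ker ψ', fun x y hxy => hinj ?_⟩,
      Subtype.ext (Subtype.ext (Con.ext fun a b => ?_))⟩
    · have hxy : ψ' (g (f x)) = ψ' (g (f y)) := (Con.eq _).1 hxy
      rw [hψ', hψ', hψ] at hxy
      exact (Con.eq _).2 hxy
    · change ψ' (g a) = ψ' (g b) ↔ c a b
      rw [hψ', hψ', hψ]

theorem SCong.isOpen_setOf_not (a b : A) : IsOpen {c : SCong f | ¬ c.1.1 a b} :=
  (isOpen_basicOpen a b).preimage continuous_subtype_val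

theorem SCong.isOpenEmbedding_map {h : A} (hg : IsAway h g) :
    Topology.IsOpenEmbedding (SCong.map f g f' hgf) :=
  ⟨SCong.isEmbedding_map f g f' hgf hg, by
    rw [SCong.range_map f g f' hgf hg]; exact SCong.isOpen_setOf_not f h 0⟩

end Away

/-! ## Localization of affine monoid schemes -/

namespace MSpec

/-! ### Principal opens, their closed points and their sections -/

section Basic

variable {A : Type u} [CommMonoidWithZero A]

/-- The principal open of `h`, as an element of `Opens (MSpec A)`. -/
def opensBasic (h : A) : Opens (MSpec A) := ⟨basicOpen h, isOpen_generateFrom_of_mem ⟨h, rfl⟩⟩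

theorem mul_mem_iff (p : MSpec A) (a b : A) : a * b ∈ p.ideal ↔ a ∈ p.ideal ∨ b ∈ p.ideal := by
  refine ⟨p.mem_or_mem a b, ?_⟩
  rintro (h | h)
  · rw [mul_comm]
    exact p.mul_mem b a h
  · exact p.mul_mem a b h

theorem basicOpen_mul (a b : A) : basicOpen (a * b) = basicOpen a ∩ basicOpen b := by
  ext p
  exact (not_congr (p.mul_mem_iff a b)).trans not_or

theorem notMem_of_dvd (p : MSpec A) {a b : A} (hab : a ∣ b) (hb : b ∉ p.ideal) : a ∉ p.ideal := by
  obtain ⟨c, rfl⟩ := hab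
  exact fun h => hb ((p.mul_mem_iff a c).2 (Or.inl h))

theorem pow_notMem (p : MSpec A) {a : A} (ha : a ∉ p.ideal) (n : ℕ) : a ^ n ∉ p.ideal :=
  p.compl.pow_mem (x := a) ha n

theorem notMem_of_isUnit (p : MSpec A) {a : A} (ha : IsUnit a) : a ∉ p.ideal :=
  p.notMem_of_dvd ha.dvd p.one_notMem

theorem exists_basicOpen_subset {O : Set (MSpec A)} (hO : IsOpen O) {p : MSpec A} (hp : p ∈ O) :
    ∃ h : A, p ∈ basicOpen h ∧ basicOpen h ⊆ O := by
  induction hO with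
  | basic s hs =>
    obtain ⟨h, rfl⟩ := hs
    exact ⟨h, hp, subset_rfl⟩
  | univ => exact ⟨1, p.one_notMem, Set.subset_univ _⟩
  | inter s t _ _ hs ht =>
    obtain ⟨a, ha, has⟩ := hs hp.1
    obtain ⟨b, hb, hbt⟩ := ht hp.2
    refine ⟨a * b, ?_, ?_⟩
    · rw [basicOpen_mul]
      exact ⟨ha, hb⟩
    · rw [basicOpen_mul]
      exact Set.inter_subset_inter has hbt
  | sUnion S _ ih =>
    obtain ⟨s, hs, hps⟩ := hp
    obtain ⟨h, hh, hhs⟩ := ih s hs hps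
    exact ⟨h, hh, hhs.trans (Set.subset_sUnion_of_mem hs)⟩

instance : T0Space (MSpec A) := by
  refine ⟨fun p q h => MSpec.ext (Set.ext fun a => ?_)⟩
  exact not_iff_not.1 (h.mem_open_iff (opensBasic a).2)

/-- The largest prime ideal that does not contain `h`. -/
def largest (h : A) (hn : ∀ n : ℕ, h ^ n ≠ 0) : MSpec A where
  ideal := {a | ∀ n : ℕ, ¬ a ∣ h ^ n}
  zero_mem n hd := hn n (zero_dvd_iff.1 hd)
  mul_mem a x hx n hd := hx n ((dvd_mul_left x a).trans hd)
  one_notMem h' := h' 0 (one_dvd _)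
  mem_or_mem a b hab := by
    by_contra! hc
    simp only [Set.mem_ofPred_eq, not_forall, not_not] at hc
    obtain ⟨⟨n, ha⟩, m, hb⟩ := hc
    exact hab (n + m) (by rw [pow_add]; exact mul_dvd_mul ha hb)

theorem largest_mem (h : A) (hn : ∀ n : ℕ, h ^ n ≠ 0) : largest h hn ∈ basicOpen h :=
  fun h' => h' 1 (by rw [pow_one])

theorem notMem_largest {h : A} {hn : ∀ n : ℕ, h ^ n ≠ 0} {a : A}
    (ha : a ∉ (largest h hn).ideal) : ∃ n : ℕ, a ∣ h ^ n := by
  simpa [largest] using ha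

/-- An element outside `largest h hn` divides a power of `h`, hence avoids every prime that avoids
`h`. So `largest h hn` is the closed point of the principal open. -/
theorem basicOpen_subset {h : A} {hn : ∀ n : ℕ, h ^ n ≠ 0} {O : Set (MSpec A)} (hO : IsOpen O)
    (hm : largest h hn ∈ O) : basicOpen h ⊆ O := by
  obtain ⟨a, ha, haO⟩ := exists_basicOpen_subset hO hm
  obtain ⟨n, hd⟩ := notMem_largest ha
  exact fun p hp => haO (p.notMem_of_dvd hd (p.pow_notMem hp n))

theorem basicOpen_one : basicOpen (1 : A) = Set.univ :=
  Set.eq_univ_of_forall fun p => p.one_notMem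

theorem mk_eq_mk_iff {S : Submonoid A} {a b : A} {s t : S} :
    Localization.mk a s = Localization.mk b t ↔ ∃ c ∈ S, c * (t * a) = c * (s * b) := by
  rw [Localization.mk_eq_mk_iff, Localization.r_iff_exists]
  exact ⟨fun ⟨c, h⟩ => ⟨c, c.2, h⟩, fun ⟨c, hc, h⟩ => ⟨⟨c, hc⟩, h⟩⟩

/-- The sections over the principal open of `h` are the localization `A[h⁻¹]`. -/
theorem isAway_toSec (h : A) (U : Opens (MSpec A)) (hU : (U : Set (MSpec A)) = basicOpen h) :
    IsAway h (toSec U) := by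
  have hmem : ∀ p : U, h ∈ p.1.compl := fun p => by
    have : p.1 ∈ (U : Set (MSpec A)) := p.2
    rwa [hU] at this
  by_cases hn : ∀ n : ℕ, h ^ n ≠ 0
  · have hL : largest h hn ∈ U := by
      change _ ∈ (U : Set (MSpec A))
      rw [hU]
      exact largest_mem h hn
    refine isAway_iff.2 ⟨?_, ?_, ?_⟩
    · refine IsUnit.of_mul_eq_one (⟨fun p => Localization.mk 1 ⟨h, hmem p⟩,
        fun p => ⟨U, p.2, le_rfl, 1, h, fun q hq => ⟨hmem ⟨q, hq⟩, rfl⟩⟩⟩ : Sec U)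
        (Sec.ext fun p => ?_)
      change Localization.mk h 1 * Localization.mk 1 _ = 1
      rw [Localization.mk_mul, mul_one, one_mul]
      exact Localization.mk_self (⟨h, hmem p⟩ : p.1.compl)
    · intro s
      -- A single fraction near the closed point represents `s` on all of `U`, and its denominator
      -- divides a power of `h`.
      obtain ⟨V, hpV, hVU, a, g, hV⟩ := s.2 ⟨_, hL⟩
      have hUV : ∀ q ∈ U, q ∈ V := fun q hq =>
        basicOpen_subset (hn := hn) V.2 hpV (hU ▸ hq : q ∈ basicOpen h)
      obtain ⟨hg, -⟩ := hV _ hpV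
      obtain ⟨n, b, hb⟩ := notMem_largest (hn := hn) hg
      refine ⟨a * b, n, Sec.ext fun p => ?_⟩
      rw [← map_pow]
      obtain ⟨hg', hs⟩ := hV p.1 (hUV p.1 p.2)
      change s.1 p * Localization.mk (h ^ n) 1 = Localization.mk (a * b) 1
      rw [hs, Localization.mk_mul, mk_eq_mk_iff]
      refine ⟨1, p.1.compl.one_mem, ?_⟩
      simp only [Submonoid.coe_one, hb, one_mul, mul_one]
      rw [mul_left_comm]
    · intro a b hab
      have hab : Localization.mk a 1 = Localization.mk b 1 :=
        congrArg (fun s : Sec U => s.1 ⟨_, hL⟩) hab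
      obtain ⟨c, hc, h'⟩ := mk_eq_mk_iff.1 hab
      obtain ⟨n, d, hd⟩ := notMem_largest (hn := hn) hc
      refine ⟨n, ?_⟩
      simp only [Submonoid.coe_one, one_mul] at h'
      rw [hd, mul_right_comm, h', mul_right_comm]
  -- If `h` is nilpotent, then `U` is empty and both its sections and the localization are trivial.
  · push Not at hn
    obtain ⟨n, hn⟩ := hn
    have : Subsingleton (Sec U) := ⟨fun s t => Sec.ext fun p =>
      absurd (p.1.zero_mem) (hn ▸ p.1.pow_notMem (hmem p) n)⟩
    exact isAway_iff.2 ⟨isUnit_of_subsingleton _, fun x => ⟨0, 0, Subsingleton.elim _ _⟩,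
      fun a b _ => ⟨n, by rw [hn, zero_mul, zero_mul]⟩⟩

theorem bijective_toSec (U : Opens (MSpec A)) (hU : (U : Set (MSpec A)) = Set.univ) :
    Function.Bijective (toSec U) := by
  have := isAway_toSec 1 U (hU.trans basicOpen_one.symm)
  constructor
  · intro a b hab
    obtain ⟨n, hn⟩ := this.exists_of_eq hab
    simpa using hn
  · intro x
    obtain ⟨a, n, ha⟩ := this.surj x
    exact ⟨a, by simpa using ha.symm⟩

end Basic

/-! ### The open immersion induced by a localization -/

section Comap

variable {A : Type u} [CommMonoidWithZero A] {A' : Type u} [CommMonoidWithZero A']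

/-- The preimage of a prime ideal. -/
def comap (g : A →*₀ A') (q : MSpec A') : MSpec A where
  ideal := g ⁻¹' q.ideal
  zero_mem := by rw [Set.mem_preimage, map_zero]; exact q.zero_mem
  mul_mem a x hx := by rw [Set.mem_preimage, map_mul]; exact q.mul_mem _ _ hx
  one_notMem := by rw [Set.mem_preimage, map_one]; exact q.one_notMem
  mem_or_mem a b hab := by
    rw [Set.mem_preimage, map_mul] at hab
    exact q.mem_or_mem _ _ hab

theorem mem_compl_of_comap (g : A →*₀ A') (q : MSpec A') :
    ∀ a ∈ (comap g q).compl, g a ∈ q.compl := fun _ ha => ha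

theorem continuous_comap (g : A →*₀ A') : Continuous (comap g) := by
  refine continuous_generateFrom_iff.2 ?_
  rintro _ ⟨a, rfl⟩
  exact (opensBasic (g a)).2

theorem range_comap {h : A} {g : A →*₀ A'} (hg : IsAway h g) :
    Set.range (comap g) = basicOpen h := by
  ext p
  constructor
  · rintro ⟨q, rfl⟩
    exact q.notMem_of_isUnit hg.isUnit
  · intro hp
    -- Two numerators of the same fraction agree up to powers of `h`, which lie outside `p`; so
    -- membership of the numerator in `p` is well defined.
    have hpow : ∀ {x : A'} {a b : A} {n m : ℕ}, x * g h ^ n = g a → x * g h ^ m = g b →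
        a ∈ p.ideal → b ∈ p.ideal := by
      intro x a b n m ha hb hap
      have : g (h ^ n * b) = g (h ^ m * a) := by
        rw [map_mul, map_mul, ← ha, ← hb, map_pow, map_pow, mul_left_comm, mul_left_comm (g h ^ m),
          mul_comm (g h ^ n)]
      obtain ⟨l, hl⟩ := hg.exists_of_eq this
      have hmem : h ^ l * (h ^ n * b) ∈ p.ideal := hl ▸ p.mul_mem _ _ (p.mul_mem _ _ hap)
      rw [mul_mem_iff, mul_mem_iff] at hmem
      exact (hmem.resolve_left (p.pow_notMem hp l)).resolve_left (p.pow_notMem hp n)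
    have hmap : ∀ a : A, a ∈ p.ideal ↔ ∃ b ∈ p.ideal, ∃ n : ℕ, g a * g h ^ n = g b := fun a =>
      ⟨fun ha => ⟨a, ha, 0, by rw [pow_zero, mul_one]⟩, fun ⟨b, hb, n, hab⟩ =>
        hpow (m := 0) hab (by rw [pow_zero, mul_one]) hb⟩
    refine ⟨⟨{x | ∃ a ∈ p.ideal, ∃ n : ℕ, x * g h ^ n = g a}, ?_, ?_, ?_, ?_⟩, ?_⟩
    · exact ⟨0, p.zero_mem, 0, by rw [zero_mul, map_zero]⟩
    · rintro y x ⟨a, ha, n, hx⟩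
      obtain ⟨b, m, hb⟩ := hg.surj y
      refine ⟨b * a, p.mul_mem _ _ ha, m + n, ?_⟩
      rw [map_mul, ← hb, ← hx, pow_add, mul_mul_mul_comm]
    · rw [Set.mem_ofPred_eq, ← map_one g, ← hmap]
      exact p.one_notMem
    · rintro x y ⟨c, hc, l, hxy⟩
      obtain ⟨a, n, ha⟩ := hg.surj x
      obtain ⟨b, m, hb⟩ := hg.surj y
      have : x * y * g h ^ (n + m) = g (a * b) := by
        rw [map_mul, ← hb, ← ha, pow_add, mul_mul_mul_comm]
      exact (p.mem_or_mem _ _ (hpow hxy this hc)).imp (fun h => ⟨a, h, n, ha⟩)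
        fun h => ⟨b, h, m, hb⟩
    · ext a
      exact (hmap a).symm

theorem isOpenEmbedding_comap {h : A} {g : A →*₀ A'} (hg : IsAway h g) :
    Topology.IsOpenEmbedding (comap g) := by
  have : Topology.IsInducing (comap g) := by
    refine ⟨le_antisymm (continuous_iff_le_induced.1 (continuous_comap g)) (le_generateFrom ?_)⟩
    rintro _ ⟨x, rfl⟩
    obtain ⟨a, n, ha⟩ := hg.surj x
    refine isOpen_induced_iff.2 ⟨_, (opensBasic a).2, ?_⟩
    ext q
    change g a ∉ q.ideal ↔ x ∉ q.ideal
    rw [← ha, mul_mem_iff, or_iff_left (q.pow_notMem (q.notMem_of_isUnit hg.isUnit) n)]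
  refine ⟨⟨this, this.injective⟩, ?_⟩
  rw [range_comap hg]
  exact (opensBasic h).2

/-- The morphism of localizations at prime ideals induced by `g`. -/
noncomputable def locMap (g : A →*₀ A') (p : MSpec A) (q : MSpec A')
    (hpq : ∀ a ∈ p.compl, g a ∈ q.compl) : Localization p.compl →* Localization q.compl :=
  (Localization.monoidOf p.compl).map (g := (g : A →* A')) (T := q.compl) (fun y => hpq y y.2)
    (Localization.monoidOf q.compl)

theorem locMap_mk (g : A →*₀ A') (p : MSpec A) (q : MSpec A')
    (hpq : ∀ a ∈ p.compl, g a ∈ q.compl) (a : A) (s : p.compl) :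
    locMap g p q hpq (Localization.mk a s) = Localization.mk (g a) ⟨g s, hpq s s.2⟩ := by
  rw [Localization.mk_eq_monoidOf_mk'_apply, Localization.mk_eq_monoidOf_mk'_apply]
  exact Submonoid.LocalizationMap.map_mk' _ _ _ _

theorem locMap_injective {h : A} {g : A →*₀ A'} (hg : IsAway h g) (q : MSpec A') :
    Function.Injective (locMap g (comap g q) q (mem_compl_of_comap g q)) := by
  intro x y hxy
  induction x using Localization.induction_on with | H x
  induction y using Localization.induction_on with | H y
  obtain ⟨a, s⟩ := x
  obtain ⟨b, t⟩ := y
  dsimp only at hxy ⊢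
  rw [locMap_mk, locMap_mk, mk_eq_mk_iff] at hxy
  obtain ⟨c, hc, hxy⟩ := hxy
  obtain ⟨d, n, hd⟩ := hg.surj c
  have hu := q.pow_notMem (q.notMem_of_isUnit hg.isUnit)
  have hdq : g d ∉ q.ideal := by
    rw [← hd, mul_mem_iff]
    exact not_or.2 ⟨hc, hu n⟩
  have : g (d * (t * a)) = g (d * (s * b)) := by
    rw [map_mul, map_mul, map_mul, map_mul, ← hd, mul_right_comm, hxy, mul_right_comm]
  obtain ⟨m, hm⟩ := hg.exists_of_eq this
  refine mk_eq_mk_iff.2 ⟨h ^ m * d, ?_, by rw [mul_assoc, hm, mul_assoc]⟩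
  change g (h ^ m * d) ∉ q.ideal
  rw [map_mul, map_pow, mul_mem_iff]
  exact not_or.2 ⟨hu m, hdq⟩

/-- Every fraction over `A'` is locally the image of a fraction over `A`. -/
theorem exists_locMap_eq {h : A} {g : A →*₀ A'} (hg : IsAway h g) (x y : A') :
    ∃ a b : A, ∀ (q : MSpec A') (hy : y ∈ q.compl), ∃ hb : b ∈ (comap g q).compl,
      locMap g (comap g q) q (mem_compl_of_comap g q) (Localization.mk a ⟨b, hb⟩) =
        Localization.mk x ⟨y, hy⟩ := by
  obtain ⟨a, n, ha⟩ := hg.surj x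
  obtain ⟨b, m, hb⟩ := hg.surj y
  refine ⟨a * h ^ m, b * h ^ n, fun q hy => ⟨?_, ?_⟩⟩
  · have hu := q.pow_notMem (q.notMem_of_isUnit hg.isUnit)
    change g (b * h ^ n) ∉ q.ideal
    rw [map_mul, ← hb, map_pow, mul_mem_iff, mul_mem_iff]
    exact not_or.2 ⟨not_or.2 ⟨hy, hu m⟩, hu n⟩
  · rw [locMap_mk, mk_eq_mk_iff]
    refine ⟨1, q.compl.one_mem, ?_⟩
    simp only [map_mul, map_pow, ← ha, ← hb, one_mul]
    ac_rfl

/-- The pullback of sections along `comap g`. -/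
noncomputable def secMap (g : A →*₀ A') (U : Opens (MSpec A)) :
    Sec U →*₀ Sec (Opens.comap ⟨comap g, continuous_comap g⟩ U) where
  toFun s := ⟨fun q => locMap g (comap g q.1) q.1 (mem_compl_of_comap g q.1) (s.1 ⟨comap g q.1, q.2⟩), by
    intro q
    obtain ⟨V, hpV, hVU, a, b, hV⟩ := s.2 ⟨comap g q.1, q.2⟩
    refine ⟨Opens.comap ⟨comap g, continuous_comap g⟩ V, hpV, fun q hq => hVU hq, g a, g b,
      fun q hq => ?_⟩
    obtain ⟨hb, hs⟩ := hV (comap g q) hq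
    exact ⟨hb, (congrArg _ hs).trans (locMap_mk _ _ _ _ _ _)⟩⟩
  map_zero' := Sec.ext fun q => by
    change locMap _ _ _ _ 0 = 0
    rw [← Localization.mk_zero 1, locMap_mk, map_zero, Localization.mk_zero]
  map_one' := Sec.ext fun q => map_one _
  map_mul' s t := Sec.ext fun q => map_mul _ _ _

theorem secMap_res (g : A →*₀ A') {U V : Opens (MSpec A)} (h : U ≤ V) (s : Sec V) :
    secMap g U (Sec.res h s) = Sec.res
      (OrderHomClass.mono (Opens.comap ⟨comap g, continuous_comap g⟩) h) (secMap g V s) := rfl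

/-- Sections are families of stalk elements, and inverting `h` does not change the stalks at primes
avoiding `h`. Local fractions descend because `comap g` is an open map. -/
theorem bijective_secMap {h : A} {g : A →*₀ A'} (hg : IsAway h g) (U : Opens (MSpec A))
    (hU : (U : Set (MSpec A)) ⊆ basicOpen h) : Function.Bijective (secMap g U) := by
  have hpre : ∀ p ∈ U, ∃ q, comap g q = p := fun p hp => by
    have := hU hp
    rwa [← range_comap hg] at this
  constructor
  · intro s t hst
    refine Sec.ext ?_
    rintro ⟨p, hp⟩
    obtain ⟨q, rfl⟩ := hpre p hp
    exact locMap_injective hg q (congrArg (fun r : Sec (Opens.comap ⟨comap g, continuous_comap g⟩ U) => r.1 ⟨q, by exact hp⟩) hst)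
  · intro t
    have key : ∀ p : U, ∃ z : Localization p.1.compl, ∀ (q : MSpec A') (hq : comap g q = p.1),
        locMap g p.1 q (fun a ha => by rw [← hq] at ha; exact ha) z =
          t.1 ⟨q, by change comap g q ∈ U; rw [hq]; exact p.2⟩ := by
      rintro ⟨p, hp⟩
      obtain ⟨q, rfl⟩ := hpre p hp
      obtain ⟨V, hqV, hVU, x, y, hV⟩ := t.2 ⟨q, hp⟩
      obtain ⟨a, b, hab⟩ := exists_locMap_eq hg x y
      obtain ⟨hy, ht⟩ := hV q hqV
      obtain ⟨hb, hab⟩ := hab q hy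
      refine ⟨Localization.mk a ⟨b, hb⟩, fun q' hq' => ?_⟩
      obtain rfl := (isOpenEmbedding_comap hg).injective hq'
      rw [ht, ← hab]
    choose s hs using key
    refine ⟨⟨s, ?_⟩, Sec.ext fun q => hs ⟨comap g q.1, q.2⟩ q.1 rfl⟩
    rintro ⟨p, hp⟩
    obtain ⟨q, rfl⟩ := hpre p hp
    obtain ⟨V, hqV, hVU, x, y, hV⟩ := t.2 ⟨q, hp⟩
    obtain ⟨a, b, hab⟩ := exists_locMap_eq hg x y
    have hVU' : ∀ q ∈ V, comap g q ∈ U := fun q hq => hVU hq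
    refine ⟨⟨comap g '' V, (isOpenEmbedding_comap hg).isOpenMap _ V.2⟩, ⟨q, hqV, rfl⟩, ?_, a, b, ?_⟩
    · rintro _ ⟨q, hq, rfl⟩
      exact hVU' q hq
    · rintro _ ⟨q, hq, rfl⟩
      obtain ⟨hy, ht⟩ := hV q hq
      obtain ⟨hb, hab⟩ := hab q hy
      refine ⟨hb, locMap_injective hg q ?_⟩
      rw [hs ⟨comap g q, hVU' q hq⟩ q rfl, ht, ← hab]

end Comap

end MSpec

namespace MonoidalSpace

/-! ## Germs and isomorphisms of monoidal spaces -/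

section Germ

variable (X : MonoidalSpace.{u})

theorem germ_res (x : X) {V W : Opens X} (h : W ≤ V) (hx : x ∈ W) (s : X.sec V) :
    X.germ x W hx (X.res h s) = X.germ x V (h hx) s :=
  Quotient.sound ⟨OrderDual.toDual (⟨W, hx⟩ : OpenNhdsOf x), le_rfl, h, X.res_refl _ _⟩

theorem germ_one (x : X) (V : Opens X) (hx : x ∈ V) : X.germ x V hx 1 = 1 :=
  (DirectLimit.one_def (f := X.nhdsRes x) (OrderDual.toDual (⟨V, hx⟩ : OpenNhdsOf x))).symm

theorem germ_mul (x : X) (V : Opens X) (hx : x ∈ V) (s t : X.sec V) :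
    X.germ x V hx (s * t) = X.germ x V hx s * X.germ x V hx t :=
  (DirectLimit.mul_def (G := fun U : (OpenNhdsOf x)ᵒᵈ => X.sec (OrderDual.ofDual U).toOpens)
    (f := X.nhdsRes x) (OrderDual.toDual (⟨V, hx⟩ : OpenNhdsOf x)) s t).symm

theorem exists_germ_eq (x : X) (z : X.stalk x) :
    ∃ (V : Opens X) (hx : x ∈ V) (s : X.sec V), z = X.germ x V hx s := by
  obtain ⟨i, s, h⟩ := DirectLimit.exists_eq_mk (f := X.nhdsRes x) z
  exact ⟨(OrderDual.ofDual i).toOpens, (OrderDual.ofDual i).mem, s, h⟩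

theorem exists_res_eq_of_germ_eq (x : X) {V : Opens X} (hx : x ∈ V) {s t : X.sec V}
    (h : X.germ x V hx s = X.germ x V hx t) :
    ∃ (W : Opens X) (hW : W ≤ V), x ∈ W ∧ X.res hW s = X.res hW t := by
  obtain ⟨i, hi, _, h⟩ := Quotient.exact h
  exact ⟨(OrderDual.ofDual i).toOpens, hi, (OrderDual.ofDual i).mem, h⟩

theorem isUnit_germ_iff (x : X) {V : Opens X} (hx : x ∈ V) (s : X.sec V) :
    IsUnit (X.germ x V hx s) ↔ ∃ (W : Opens X) (hW : W ≤ V), x ∈ W ∧ IsUnit (X.res hW s) := by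
  constructor
  · intro h
    obtain ⟨z, hz⟩ := h.exists_right_inv
    obtain ⟨W, hxW, t, rfl⟩ := X.exists_germ_eq x z
    have hxVW : x ∈ V ⊓ W := ⟨hx, hxW⟩
    rw [← X.germ_res x inf_le_left hxVW, ← X.germ_res x (W := V ⊓ W) inf_le_right hxVW, ← germ_mul,
      ← X.germ_one x _ hxVW] at hz
    obtain ⟨O, hO, hxO, h⟩ := X.exists_res_eq_of_germ_eq x hxVW hz
    rw [map_mul, map_one, X.res_res] at h
    exact ⟨O, hO.trans inf_le_left, hxO, IsUnit.of_mul_eq_one _ h⟩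
  · rintro ⟨W, hW, hxW, h⟩
    obtain ⟨t, ht⟩ := h.exists_right_inv
    refine IsUnit.of_mul_eq_one (X.germ x W hxW t) ?_
    rw [← X.germ_res x hW hxW, ← germ_mul, ht, germ_one]

theorem res_bijective {V W : Opens X} (h : W ≤ V) (h' : V ≤ W) : Function.Bijective (X.res h) :=
  Function.bijective_iff_has_inverse.2 ⟨X.res h',
    fun s => (X.res_res h' h s).trans (X.res_refl _ s),
    fun s => (X.res_res h h' s).trans (X.res_refl _ s)⟩

end Germ

/-! ### Isomorphisms from homeomorphisms -/

section Iso

variable {X Y : MonoidalSpace.{u}}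

/-- The two sections live over opens that agree only propositionally, so they are compared by a
restriction map instead of a cast. -/
theorem Hom.ext_of_base_eq {f g : Hom X Y} (hb : f.base = g.base)
    (h : ∀ (V : Opens Y) (s : Y.sec V) (hle : Opens.comap g.base V ≤ Opens.comap f.base V),
      X.res hle (f.app V s) = g.app V s) : f = g := by
  obtain ⟨b, a, n, l⟩ := f
  obtain ⟨b', a', n', l'⟩ := g
  obtain rfl : b = b' := hb
  obtain rfl : a = a' := by
    funext V
    ext s
    exact (X.res_refl _ _).symm.trans (h V s le_rfl)
  rfl

/-- A morphism from a homeomorphism with compatible isomorphisms on sections. -/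
def Hom.ofHomeomorph (e : X ≃ₜ Y)
    (app : ∀ V : Opens Y, Y.sec V →*₀ X.sec (Opens.comap (e : C(X, Y)) V))
    (naturality : ∀ {V W : Opens Y} (h : V ≤ W) (s : Y.sec W),
      app V (Y.res h s) = X.res (OrderHomClass.mono (Opens.comap (e : C(X, Y))) h) (app W s))
    (bijective : ∀ V, Function.Bijective (app V)) : Hom X Y where
  base := e
  app := app
  naturality := naturality
  isLocal x V hx s h := by
    obtain ⟨W, hW, hxW, h⟩ := (X.isUnit_germ_iff x hx _).1 h
    have hle : Opens.comap (e.symm : C(Y, X)) W ≤ V := by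
      intro y hy
      have h' : e (e.symm y) ∈ V := hW hy
      rwa [e.apply_symm_apply] at h'
    have hle' : Opens.comap (e : C(X, Y)) (Opens.comap (e.symm : C(Y, X)) W) ≤ W := by
      intro y hy
      have h' : e.symm (e y) ∈ W := hy
      rwa [e.symm_apply_apply] at h'
    refine (Y.isUnit_germ_iff (e x) hx s).2 ⟨Opens.comap (e.symm : C(Y, X)) W, hle, ?_, ?_⟩
    · change e.symm (e x) ∈ W
      rwa [e.symm_apply_apply]
    · have h := h.map (X.res hle')
      rw [X.res_res] at h
      have h2 := naturality hle s
      rw [← h2] at h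
      exact (isUnit_map_iff (MulEquiv.ofBijective (app _) (bijective _)) _).1 h

theorem nonempty_iso_of_homeomorph (e : X ≃ₜ Y)
    (app : ∀ V : Opens Y, Y.sec V →*₀ X.sec (Opens.comap (e : C(X, Y)) V))
    (naturality : ∀ {V W : Opens Y} (h : V ≤ W) (s : Y.sec W),
      app V (Y.res h s) = X.res (OrderHomClass.mono (Opens.comap (e : C(X, Y))) h) (app W s))
    (bijective : ∀ V, Function.Bijective (app V)) : Nonempty (X ≅ Y) := by
  have hle : ∀ U : Opens X, Opens.comap (e : C(X, Y)) (Opens.comap (e.symm : C(Y, X)) U) ≤ U := by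
    intro U y hy
    have h' : e.symm (e y) ∈ U := hy
    rwa [e.symm_apply_apply] at h'
  have hle' : ∀ U : Opens X,
      U ≤ Opens.comap (e : C(X, Y)) (Opens.comap (e.symm : C(Y, X)) U) := by
    intro U y hy
    change e.symm (e y) ∈ U
    rwa [e.symm_apply_apply]
  let inv : ∀ V, X.sec (Opens.comap (e : C(X, Y)) V) →*₀ Y.sec V := fun V =>
    { (MulEquiv.ofBijective (app V) (bijective V)).symm.toMonoidHom with
      map_zero' := (MulEquiv.symm_apply_eq _).2 (map_zero (app V)).symm }
  have hinv : ∀ V s, app V (inv V s) = s := fun V s =>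
    (MulEquiv.ofBijective (app V) (bijective V)).apply_symm_apply s
  let app' : ∀ U : Opens X, X.sec U →*₀ Y.sec (Opens.comap (e.symm : C(Y, X)) U) := fun U =>
    (inv _).comp (X.res (hle U))
  have happ' : ∀ U s, app _ (app' U s) = X.res (hle U) s := fun U s => hinv _ _
  have nat' : ∀ {V W : Opens X} (h : V ≤ W) (s : X.sec W), app' V (X.res h s) =
      Y.res (OrderHomClass.mono (Opens.comap (e.symm : C(Y, X))) h) (app' W s) := by
    intro V W h s
    apply (bijective _).1
    rw [happ', naturality, happ', X.res_res, X.res_res]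
  have bij' : ∀ U, Function.Bijective (app' U) := fun U =>
    (MulEquiv.ofBijective (app _) (bijective _)).symm.bijective.comp
      (X.res_bijective (hle U) (hle' U))
  refine ⟨⟨Hom.ofHomeomorph e app naturality bijective, Hom.ofHomeomorph e.symm app' nat' bij',
    Hom.ext_of_base_eq (ContinuousMap.ext fun x => e.symm_apply_apply x) fun U s h => ?_,
    Hom.ext_of_base_eq (ContinuousMap.ext fun x => e.apply_symm_apply x) fun V s h => ?_⟩⟩
  · have h' := hle' U
    have : X.res h' (app _ (app' U s)) = s := by rw [happ', X.res_res, X.res_refl]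
    exact this
  · have h' : V ≤ Opens.comap (e.symm : C(Y, X)) (Opens.comap (e : C(X, Y)) V) := h
    have : Y.res h' (app' _ (app V s)) = s := by
      apply (bijective _).1
      rw [naturality, happ', X.res_res, X.res_refl]
    exact this

end Iso

/-! ## Affine charts -/

/-- An open immersion of `MSpec A` onto the open subset `V` of `X`, as a map on points with
compatible maps on sections. -/
structure Chart (X : MonoidalSpace.{u}) (V : Opens X) (A : Type u) [CommMonoidWithZero A] where
  base : C(MSpec A, X)
  isOpenEmbedding : Topology.IsOpenEmbedding base
  range_eq : Set.range base = V
  app : ∀ W : Opens X, X.sec W →*₀ MSpec.Sec (Opens.comap base W)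
  naturality : ∀ {W W' : Opens X} (h : W ≤ W') (s : X.sec W'),
    app W (X.res h s) = MSpec.Sec.res (OrderHomClass.mono (Opens.comap base) h) (app W' s)
  bijective : ∀ W ≤ V, Function.Bijective (app W)

section Chart

variable {X : MonoidalSpace.{u}} {V : Opens X} {A : Type u} [CommMonoidWithZero A]

theorem hom_app_bijective {X Y : MonoidalSpace.{u}} (e : X ≅ Y) (V : Opens Y) :
    Function.Bijective (Hom.app e.hom V) := by
  have key : ∀ {Z : MonoidalSpace.{u}} (f g : Z ⟶ Z) (h : f = g) (U : Opens Z) (s : Z.sec U)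
      (hle : Opens.comap (Hom.base g) U ≤ Opens.comap (Hom.base f) U),
      Z.res hle (Hom.app f U s) = Hom.app g U s := by
    rintro Z f _ rfl U s hle
    exact Z.res_refl _ _
  have hb : ∀ x, Hom.base e.inv (Hom.base e.hom x) = x := fun x =>
    congrArg (fun f : X ⟶ X => Hom.base f x) e.hom_inv_id
  have hb' : ∀ x, Hom.base e.hom (Hom.base e.inv x) = x := fun x =>
    congrArg (fun f : Y ⟶ Y => Hom.base f x) e.inv_hom_id
  have h1 : V ≤ Opens.comap (Hom.base e.inv) (Opens.comap (Hom.base e.hom) V) := fun y hy => by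
    change Hom.base e.hom (Hom.base e.inv y) ∈ V
    rwa [hb']
  have h2 : ∀ U : Opens X, U ≤ Opens.comap (Hom.base (e.hom ≫ e.inv)) U := fun U y hy => by
    change Hom.base e.inv (Hom.base e.hom y) ∈ U
    rwa [hb]
  constructor
  · intro s t hst
    have hs := key _ _ e.inv_hom_id V s h1
    have ht := key _ _ e.inv_hom_id V t h1
    refine hs.symm.trans (Eq.trans ?_ ht)
    exact congrArg (fun z => Y.res h1 (Hom.app e.inv _ z)) hst
  · intro t
    refine ⟨Y.res h1 (Hom.app e.inv _ t), (Hom.naturality e.hom h1 _).trans ?_⟩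
    exact key _ _ e.hom_inv_id _ t (h2 _)

/-- A chart maps directly to `X`, so opens of `X` can be pulled back without passing through the
restricted space. `Chart.isAffineOpen` is the converse. -/
theorem IsAffineOpen.exists_chart (hV : X.IsAffineOpen V) :
    ∃ (A : Type u) (_ : CommMonoidWithZero A), Nonempty (X.Chart V A) := by
  obtain ⟨A, _, ⟨e⟩⟩ := hV
  let b : C(MSpec A, V) := Hom.base e.inv
  have hb : ∀ x, Hom.base e.inv (Hom.base e.hom x) = x := fun x =>
    congrArg (fun f : X.restrict V ⟶ X.restrict V => Hom.base f x) e.hom_inv_id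
  have hb' : ∀ x, Hom.base e.hom (Hom.base e.inv x) = x := fun x =>
    congrArg (fun f : MSpec.space A ⟶ MSpec.space A => Hom.base f x) e.inv_hom_id
  let ε : MSpec A ≃ₜ V :=
    { toFun := b
      invFun := Hom.base e.hom
      left_inv := hb'
      right_inv := hb
      continuous_toFun := b.continuous
      continuous_invFun := (Hom.base e.hom).continuous }
  let ι : C((X.restrict V).carrier, X) := ⟨Subtype.val, continuous_subtype_val⟩
  have himg : ∀ W : Opens X, image V (Opens.comap ι W) ≤ W := by
    rintro W _ ⟨x, hx, rfl⟩
    exact hx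
  refine ⟨A, inferInstance, ⟨⟨ι.comp b, V.2.isOpenEmbedding_subtypeVal.comp ε.isOpenEmbedding, ?_,
    fun W => (Hom.app e.inv (Opens.comap ι W)).comp (X.res (himg W)), ?_, ?_⟩⟩⟩
  · exact (ε.surjective.range_comp Subtype.val).trans Subtype.range_coe
  · intro W W' h s
    have := Hom.naturality e.inv (V := Opens.comap ι W) (W := Opens.comap ι W')
      (OrderHomClass.mono (Opens.comap ι) h) (X.res (himg W') s)
    refine Eq.trans ?_ this
    refine congrArg (Hom.app e.inv (Opens.comap ι W)) ?_
    exact (X.res_res _ _ _).trans (X.res_res (image_mono V (OrderHomClass.mono (Opens.comap ι) h))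
      (himg W') s).symm
  · intro W hW
    exact (hom_app_bijective e.symm (Opens.comap ι W)).comp
      (X.res_bijective (himg W) fun x hx => ⟨⟨x, hW hx⟩, hx, rfl⟩)

theorem Chart.isAffineOpen (φ : X.Chart V A) : X.IsAffineOpen V := by
  have hmem : ∀ p, φ.base p ∈ V := fun p => by
    change _ ∈ (V : Set X)
    rw [← φ.range_eq]
    exact ⟨p, rfl⟩
  let b : MSpec A → V := fun p => ⟨φ.base p, hmem p⟩
  have hb : Topology.IsOpenEmbedding b :=
    .of_comp b V.2.isOpenEmbedding_subtypeVal φ.isOpenEmbedding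
  have hsurj : Function.Surjective b := by
    rintro ⟨x, hx⟩
    have hx' : x ∈ Set.range φ.base := by rwa [φ.range_eq]
    obtain ⟨p, rfl⟩ := hx'
    exact ⟨p, rfl⟩
  let ε : MSpec A ≃ₜ V := (Equiv.ofBijective b ⟨hb.injective, hsurj⟩).toHomeomorphOfIsInducing
    hb.isInducing
  have hle : ∀ W : Opens V, Opens.comap (ε : C(MSpec A, V)) W ≤ Opens.comap φ.base (image V W) :=
    fun W p hp => ⟨b p, hp, rfl⟩
  have hle' : ∀ W : Opens V, Opens.comap φ.base (image V W) ≤ Opens.comap (ε : C(MSpec A, V)) W := by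
    rintro W p ⟨x, hx, hxp⟩
    obtain rfl : x = b p := Subtype.ext hxp
    exact hx
  have himg : ∀ W : Opens V, image V W ≤ V := by
    rintro W _ ⟨x, -, rfl⟩
    exact x.2
  refine ⟨A, inferInstance, (nonempty_iso_of_homeomorph (X := MSpec.space A) (Y := X.restrict V) ε
    (fun W => (MSpec.Sec.res (hle W)).comp (φ.app (image V W))) ?_ ?_).map Iso.symm⟩
  · intro W W' h s
    exact congrArg (MSpec.Sec.res (hle W)) (φ.naturality (image_mono V h) s)
  · intro W
    exact ((MSpec.space A).res_bijective (hle W) (hle' W)).comp (φ.bijective _ (himg W))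

end Chart

end MonoidalSpace

namespace MonoidalSpace

/-! ## Principal opens of affine charts -/

namespace Chart

variable {X : MonoidalSpace.{u}} {V : Opens X} {A : Type u} [CommMonoidWithZero A]

theorem base_mem (φ : X.Chart V A) (p : MSpec A) : φ.base p ∈ V := by
  change _ ∈ (V : Set X)
  rw [← φ.range_eq]
  exact ⟨p, rfl⟩

theorem exists_base_eq (φ : X.Chart V A) {x : X} (hx : x ∈ V) : ∃ p, φ.base p = x := by
  have hx' : x ∈ Set.range φ.base := by rwa [φ.range_eq]
  exact hx'

theorem comap_eq_univ (φ : X.Chart V A) :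
    (Opens.comap φ.base V : Set (MSpec A)) = Set.univ :=
  Set.eq_univ_of_forall φ.base_mem

/-- The principal open of `V` defined by `a`. -/
def basic (φ : X.Chart V A) (a : A) : Opens X :=
  ⟨φ.base '' MSpec.basicOpen a, φ.isOpenEmbedding.isOpenMap _ (MSpec.opensBasic a).2⟩

theorem basic_le (φ : X.Chart V A) (a : A) : φ.basic a ≤ V := by
  rintro _ ⟨p, -, rfl⟩
  exact φ.base_mem p

theorem comap_basic (φ : X.Chart V A) (a : A) :
    (Opens.comap φ.base (φ.basic a) : Set (MSpec A)) = MSpec.basicOpen a :=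
  Set.preimage_image_eq _ φ.isOpenEmbedding.injective

theorem basic_mul (φ : X.Chart V A) (a b : A) : φ.basic (a * b) = φ.basic a ⊓ φ.basic b := by
  refine Opens.ext ?_
  change φ.base '' _ = φ.base '' _ ∩ φ.base '' _
  rw [MSpec.basicOpen_mul, Set.image_inter φ.isOpenEmbedding.injective]

/-- A chart of a principal open. -/
noncomputable def comapBasic (φ : X.Chart V A) {A' : Type u} [CommMonoidWithZero A'] {a : A}
    {g : A →*₀ A'} (hg : IsAway a g) : X.Chart (φ.basic a) A' where
  base := φ.base.comp ⟨MSpec.comap g, MSpec.continuous_comap g⟩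
  isOpenEmbedding := φ.isOpenEmbedding.comp (MSpec.isOpenEmbedding_comap hg)
  range_eq := by
    change Set.range (φ.base ∘ MSpec.comap g) = φ.base '' _
    rw [Set.range_comp, MSpec.range_comap hg]
  app W := (MSpec.secMap g (Opens.comap φ.base W)).comp (φ.app W)
  naturality {W W'} h s :=
    (congrArg (MSpec.secMap g (Opens.comap φ.base W)) (φ.naturality h s)).trans
      (MSpec.secMap_res g (OrderHomClass.mono (Opens.comap φ.base) h) (φ.app W' s))
  bijective W hW := by
    change Function.Bijective (MSpec.secMap g (Opens.comap φ.base W) ∘ φ.app W)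
    refine (MSpec.bijective_secMap hg (Opens.comap φ.base W) ?_).comp (φ.bijective W (hW.trans (φ.basic_le a)))
    rw [← φ.comap_basic a]
    exact fun p hp => hW hp

theorem isAffineOpen_basic (φ : X.Chart V A) (a : A) : X.IsAffineOpen (φ.basic a) := by
  let g : A →*₀ Localization (Submonoid.powers a) :=
    { (Localization.monoidOf (Submonoid.powers a)).toMonoidHom with
      map_zero' := Localization.mk_zero 1 }
  exact (φ.comapBasic (g := g)
    (Localization.monoidOf (Submonoid.powers a)).isLocalizationMap).isAffineOpen

theorem exists_app_eq (φ : X.Chart V A) (a : A) : ∃ s, φ.app V s = MSpec.toSec _ a :=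
  (φ.bijective V le_rfl).2 _

theorem isAway_res (φ : X.Chart V A) {a : A} {s : X.sec V} (hs : φ.app V s = MSpec.toSec _ a) :
    IsAway s (X.res (φ.basic_le a)) := by
  have hT := MSpec.isAway_toSec a _ (φ.comap_basic a)
  have hbij := φ.bijective _ (φ.basic_le a)
  have hnat : ∀ {t b}, φ.app V t = MSpec.toSec _ b →
      φ.app _ (X.res (φ.basic_le a) t) = MSpec.toSec _ b := by
    intro t b h
    rw [φ.naturality, h]
    rfl
  have hex : ∀ t, ∃ b, φ.app V t = MSpec.toSec _ b := fun t =>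
    ((MSpec.bijective_toSec _ φ.comap_eq_univ).2 (φ.app V t)).imp fun _ h => h.symm
  refine isAway_iff.2 ⟨?_, fun x => ?_, fun t t' h => ?_⟩
  · have h := hT.isUnit
    rw [← hnat hs] at h
    exact (isUnit_map_iff (MulEquiv.ofBijective (φ.app _) hbij) _).1 h
  · obtain ⟨b, n, hb⟩ := hT.surj (φ.app _ x)
    obtain ⟨t, ht⟩ := φ.exists_app_eq b
    refine ⟨t, n, hbij.1 ?_⟩
    rw [map_mul, map_pow, hnat hs, hnat ht, hb]
  · obtain ⟨b, hb⟩ := hex t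
    obtain ⟨b', hb'⟩ := hex t'
    have h := congrArg (φ.app _) h
    rw [hnat hb, hnat hb'] at h
    obtain ⟨n, hn⟩ := hT.exists_of_eq h
    refine ⟨n, (φ.bijective V le_rfl).1 ?_⟩
    rw [map_mul, map_mul, map_pow, hs, hb, hb', ← map_pow, ← map_mul, hn, map_mul]

/-- An affine open is contained in every open subset that contains its closed point. -/
theorem le_of_base_largest_mem (φ : X.Chart V A) (h1 : ∀ n : ℕ, (1 : A) ^ n ≠ 0) {O : Opens X}
    (hO : φ.base (MSpec.largest 1 h1) ∈ O) : V ≤ O := by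
  intro x hx
  obtain ⟨p, rfl⟩ := φ.exists_base_eq hx
  exact MSpec.basicOpen_subset (hn := h1) (Opens.comap φ.base O).2 hO p.one_notMem

theorem subsingleton (h1 : ¬ ∀ n : ℕ, (1 : A) ^ n ≠ 0) : Subsingleton A := by
  push Not at h1
  obtain ⟨n, hn⟩ := h1
  rw [one_pow] at hn
  exact subsingleton_of_zero_eq_one hn.symm

theorem exists_eq_basic (φ : X.Chart V A) {W : Opens X} {C : Type u} [CommMonoidWithZero C]
    (ψ : X.Chart W C) (hW : W ≤ V) : ∃ a, W = φ.basic a := by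
  by_cases h1 : ∀ n : ℕ, (1 : C) ^ n ≠ 0
  · obtain ⟨p, hp⟩ := φ.exists_base_eq (hW (ψ.base_mem (MSpec.largest 1 h1)))
    have hpW : p ∈ Opens.comap φ.base W := by
      change φ.base p ∈ W
      rw [hp]
      exact ψ.base_mem _
    obtain ⟨a, ha, haW⟩ := MSpec.exists_basicOpen_subset (Opens.comap φ.base W).2 hpW
    refine ⟨a, le_antisymm (ψ.le_of_base_largest_mem h1 ⟨p, ha, hp⟩) ?_⟩
    rintro _ ⟨q, hq, rfl⟩
    exact haW hq
  -- Here `W` is empty, hence the principal open of `0`.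
  · have := subsingleton h1
    refine ⟨0, le_antisymm (fun x hx => ?_) ?_⟩
    · obtain ⟨p, rfl⟩ := ψ.exists_base_eq hx
      exact absurd (Subsingleton.elim (0 : C) 1 ▸ p.zero_mem) p.one_notMem
    · rintro _ ⟨q, hq, rfl⟩
      exact absurd q.zero_mem hq

end Chart

variable {X : MonoidalSpace.{u}}

/-- Affine opens contained in an affine open are principal, and so are their intersections. -/
theorem IsAffineOpen.exists_isAway {V W W' : Opens X} (hV : X.IsAffineOpen V)
    (hW : X.IsAffineOpen W) (hW' : X.IsAffineOpen W') (hWV : W ≤ V) (hWV' : W' ≤ V) :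
    X.IsAffineOpen (W ⊓ W') ∧ ∃ h h' : X.sec V, IsAway h (X.res hWV) ∧ IsAway h' (X.res hWV') ∧
      IsAway (h * h') (X.res (inf_le_left.trans hWV : W ⊓ W' ≤ V)) := by
  obtain ⟨A, _, ⟨φ⟩⟩ := hV.exists_chart
  obtain ⟨C, _, ⟨ψ⟩⟩ := hW.exists_chart
  obtain ⟨C', _, ⟨ψ'⟩⟩ := hW'.exists_chart
  obtain ⟨a, rfl⟩ := φ.exists_eq_basic ψ hWV
  obtain ⟨a', rfl⟩ := φ.exists_eq_basic ψ' hWV'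
  obtain ⟨h, hh⟩ := φ.exists_app_eq a
  obtain ⟨h', hh'⟩ := φ.exists_app_eq a'
  have key : ∀ (O : Opens X) (hO : O ≤ V), φ.basic (a * a') = O →
      X.IsAffineOpen O ∧ IsAway (h * h') (X.res hO) := by
    rintro _ hO rfl
    exact ⟨φ.isAffineOpen_basic _, φ.isAway_res (by rw [map_mul, map_mul, hh, hh'])⟩
  obtain ⟨h1, h2⟩ := key _ (inf_le_left.trans hWV) (φ.basic_mul a a')
  exact ⟨h1, h, h', φ.isAway_res hh, φ.isAway_res hh', h2⟩

theorem IsAffineOpen.exists_isAway_res {V W : Opens X} (hV : X.IsAffineOpen V)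
    (hW : X.IsAffineOpen W) (hWV : W ≤ V) : ∃ h : X.sec V, IsAway h (X.res hWV) := by
  obtain ⟨-, h, -, hh, -⟩ := hV.exists_isAway hW hW hWV hWV
  exact ⟨h, hh⟩

/-- The sections over the affine opens of a `k`-scheme locally of finite type are finitely
generated `k`-algebras. -/
theorem IsLocallyOfFiniteType.isFinitelyGenerated {k : Type u} [CommMonoidWithZero k]
    [Nontrivial k] {f : X ⟶ MSpec.space k} (hf : IsLocallyOfFiniteType f) {U : Opens X}
    (hU : X.IsAffineOpen U) : IsFinitelyGenerated (structureMap f U) := by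
  obtain ⟨𝒱, h𝒱, hf⟩ := hf
  have h1 : ∀ n : ℕ, (1 : k) ^ n ≠ 0 := fun n => by rw [one_pow]; exact one_ne_zero
  have hmem : MSpec.largest 1 h1 ∈ sSup 𝒱 := by
    rw [h𝒱]
    trivial
  obtain ⟨V, hV, hmemV⟩ := Opens.mem_sSup.1 hmem
  -- The member of the covering that contains the closed point of `MSpec k` is the whole space.
  obtain rfl : V = (⊤ : Opens (MSpec.space k).carrier) := by
    refine Opens.ext (Set.eq_univ_of_forall fun p => ?_)
    exact MSpec.basicOpen_subset (hn := h1) V.2 hmemV p.one_notMem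
  obtain ⟨-, 𝒲, h𝒲, hf⟩ := hf _ hV
  obtain ⟨C, _, ⟨φ⟩⟩ := hU.exists_chart
  by_cases hC : ∀ n : ℕ, (1 : C) ^ n ≠ 0
  · have hmem : φ.base (MSpec.largest 1 hC) ∈ sSup 𝒲 := by
      rw [h𝒲]
      trivial
    obtain ⟨W, hW, hmemW⟩ := Opens.mem_sSup.1 hmem
    obtain ⟨hWa, hle, hfg⟩ := hf W hW
    -- Likewise `U` lies in a single member of the covering, and its sections are a localization of
    -- finitely generated ones.
    have hUW := φ.le_of_base_largest_mem hC hmemW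
    obtain ⟨h, hh⟩ := hWa.exists_isAway_res hU hUW
    have hfgW : IsFinitelyGenerated (structureMap f W) := by
      obtain ⟨n, b, hb⟩ := hfg
      refine ⟨n, b, fun x => ?_⟩
      obtain ⟨c, m, hx⟩ := hb x
      obtain ⟨c', rfl⟩ := (MSpec.bijective_toSec (⊤ : Opens (MSpec k)) rfl).2 c
      exact ⟨c', m, hx⟩
    rw [← res_comp_structureMap f hUW]
    exact hfgW.comp_of_isAway hh
  · have := Chart.subsingleton hC
    have := (MSpec.bijective_toSec _ φ.comap_eq_univ).2.subsingleton
    have := (φ.bijective U le_rfl).1.subsingleton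
    exact ⟨0, Fin.elim0, fun x => ⟨1, Fin.elim0, Subsingleton.elim _ _⟩⟩

end MonoidalSpace

/-! ## Sobriety of the strong congruence space -/

theorem quasiSober_and_t0Space_of_cover {ι : Type u} {Y : ι → Type v} {T : Type w}
    [∀ i, TopologicalSpace (Y i)] [TopologicalSpace T] (g : ∀ i, Y i → T)
    (hg : ∀ i, Topology.IsOpenEmbedding (g i)) (hs : ∀ x, ∃ i y, g i y = x)
    [∀ i, QuasiSober (Y i)] [∀ i, T0Space (Y i)] : QuasiSober T ∧ T0Space T := by
  constructor
  · let U : ι → Opens T := fun i => ⟨Set.range (g i), (hg i).isOpen_range⟩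
    have hU : IsOpenCover U := by
      refine Opens.ext (Set.eq_univ_of_forall fun x => ?_)
      obtain ⟨i, y, rfl⟩ := hs x
      exact Opens.mem_iSup.2 ⟨i, y, rfl⟩
    have : ∀ i, QuasiSober (U i) := fun i =>
      (hg i).isEmbedding.toHomeomorph.symm.isOpenEmbedding.quasiSober
    exact hU.quasiSober
  · refine T0Space.of_open_cover fun x => ?_
    obtain ⟨i, y, rfl⟩ := hs x
    exact ⟨Set.range (g i), ⟨y, rfl⟩, (hg i).isOpen_range, (hg i).isEmbedding.toHomeomorph.t0Space⟩

/-! ### Gluing the strong congruence spaces of affine opens -/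

namespace MonoidalSpace

variable {k : Type u} [CommMonoidWithZero k] {X : MonoidalSpace.{u}} (f : X ⟶ MSpec.space k)

/-- The transition maps of the diagram of strong congruence spaces. -/
def scongRes {U V : Opens X} (h : U ≤ V) :
    C(SCong (structureMap f U), SCong (structureMap f V)) :=
  SCong.map (structureMap f V) (X.res h) (structureMap f U) (res_comp_structureMap f h)

theorem scongRes_scongRes {U V W : Opens X} (h : U ≤ V) (h' : V ≤ W)
    (d : SCong (structureMap f U)) : scongRes f h' (scongRes f h d) = scongRes f (h.trans h') d := by
  refine Subtype.ext (Subtype.ext (Con.ext fun a b => ?_))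
  change d.1.1 (X.res h (X.res h' a)) (X.res h (X.res h' b)) ↔ d.1.1 (X.res _ a) (X.res _ b)
  rw [X.res_res, X.res_res]

variable {f}

theorem IsAffineOpen.isOpenEmbedding_scongRes {U V : Opens X} (hU : X.IsAffineOpen U)
    (hV : X.IsAffineOpen V) (h : U ≤ V) : Topology.IsOpenEmbedding (scongRes f h) := by
  obtain ⟨s, hs⟩ := hV.exists_isAway_res hU h
  exact SCong.isOpenEmbedding_map _ _ _ _ hs

/-- The common image avoids both `s ~ 0` and `s' ~ 0`, hence by primality `s * s' ~ 0`, so it comes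
from the intersection. This is what makes the gluing relation transitive. -/
theorem IsAffineOpen.exists_scongRes_inf {V W W' : Opens X} (hV : X.IsAffineOpen V)
    (hW : X.IsAffineOpen W) (hW' : X.IsAffineOpen W') (h : W ≤ V) (h' : W' ≤ V)
    {d : SCong (structureMap f W)} {d' : SCong (structureMap f W')}
    (hd : scongRes f h d = scongRes f h' d') :
    X.IsAffineOpen (W ⊓ W') ∧ ∃ e : SCong (structureMap f (W ⊓ W')),
      scongRes f inf_le_left e = d ∧ scongRes f inf_le_right e = d' := by
  obtain ⟨hWW', s, s', hs, hs', hss'⟩ := hV.exists_isAway hW hW' h h'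
  have h1 : scongRes f h d ∈ Set.range (scongRes f h) := ⟨d, rfl⟩
  have h2 : scongRes f h d ∈ Set.range (scongRes f h') := ⟨d', hd.symm⟩
  have h3 : scongRes f h d ∈ Set.range (scongRes f (inf_le_left.trans h : W ⊓ W' ≤ V)) := by
    unfold scongRes at h1 h2 ⊢
    rw [SCong.range_map _ _ _ _ hs] at h1
    rw [SCong.range_map _ _ _ _ hs'] at h2
    rw [SCong.range_map _ _ _ _ hss']
    exact fun h => ((Cong.mul_zero_iff _ _ _).1 h).elim h1 h2
  obtain ⟨e, he⟩ := h3
  refine ⟨hWW', e, (hW.isOpenEmbedding_scongRes hV h).injective ?_,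
    (hW'.isOpenEmbedding_scongRes hV h').injective ?_⟩
  · rw [scongRes_scongRes, he]
  · rw [scongRes_scongRes, ← hd, ← he]

variable (f)

/-- Two strong congruences on affine opens are identified in the colimit if they come from a common
strong congruence on a smaller affine open. -/
def scongSetoid : Setoid (Σ U : X.AffineOpens, SCong (structureMap f U.1)) where
  r x y := ∃ (W : X.AffineOpens) (h : W.1 ≤ x.1.1) (h' : W.1 ≤ y.1.1)
    (d : SCong (structureMap f W.1)), scongRes f h d = x.2 ∧ scongRes f h' d = y.2
  iseqv :=
    { refl x := ⟨x.1, le_rfl, le_rfl, x.2, by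
        have : scongRes f (le_refl x.1.1) x.2 = x.2 := by
          refine Subtype.ext (Subtype.ext (Con.ext fun a b => ?_))
          change x.2.1.1 (X.res _ a) (X.res _ b) ↔ x.2.1.1 a b
          rw [X.res_refl, X.res_refl]
        exact ⟨this, this⟩⟩
      symm := fun ⟨W, h, h', d, hd, hd'⟩ => ⟨W, h', h, d, hd', hd⟩
      trans := by
        rintro x y z ⟨W, h1, h2, d, hd1, hd2⟩ ⟨W', h2', h3', d', hd2', hd3'⟩
        obtain ⟨hWW', e, he, he'⟩ := y.1.2.exists_scongRes_inf W.2 W'.2 h2 h2'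
          (hd2.trans hd2'.symm)
        refine ⟨⟨W.1 ⊓ W'.1, hWW'⟩, inf_le_left.trans h1, inf_le_right.trans h3', e, ?_, ?_⟩
        · rw [← hd1, ← he, scongRes_scongRes]
        · rw [← hd3', ← he', scongRes_scongRes] }

/-- The map from the strong congruence space of an affine open to the colimit. -/
noncomputable def scongι (U : X.AffineOpens) : SCong (structureMap f U.1) → scongSpace f :=
  Limits.colimit.ι (scongDiagram f) U

theorem exists_scongι_eq (x : scongSpace f) : ∃ U c, scongι f U c = x :=
  Limits.Concrete.colimit_exists_rep (scongDiagram f) x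

theorem scongι_scongRes {U V : X.AffineOpens} (h : U.1 ≤ V.1) (d : SCong (structureMap f U.1)) :
    scongι f V (scongRes f h d) = scongι f U d :=
  ConcreteCategory.congr_hom (Limits.colimit.w (scongDiagram f) (homOfLE h : U ⟶ V)) d

theorem scongι_eq_iff {U V : X.AffineOpens} (c : SCong (structureMap f U.1))
    (d : SCong (structureMap f V.1)) :
    scongι f U c = scongι f V d ↔ ∃ (W : X.AffineOpens) (h : W.1 ≤ U.1) (h' : W.1 ≤ V.1)
      (e : SCong (structureMap f W.1)), scongRes f h e = c ∧ scongRes f h' e = d := by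
  constructor
  · intro h
    -- To detect equality in the colimit, map it to the quotient set with the indiscrete topology,
    -- where continuity is automatic.
    let κ : Limits.Cocone (scongDiagram f) :=
      { pt := @TopCat.of (Quotient (scongSetoid f)) ⊤
        ι :=
          { app U := @TopCat.ofHom _ _ _ ⊤
              (@ContinuousMap.mk _ _ _ ⊤ (fun c => Quotient.mk (scongSetoid f) ⟨U, c⟩)
                continuous_top)
            naturality U V i := by
              refine TopCat.hom_ext (ContinuousMap.ext fun c => ?_)
              refine Quotient.sound ((scongSetoid f).symm ?_)
              have := (scongSetoid f).refl ⟨U, c⟩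
              obtain ⟨W, h, h', e, he, he'⟩ := this
              exact ⟨W, h, h'.trans (leOfHom i), e, he, by
                rw [← scongRes_scongRes f h' (leOfHom i), he']; rfl⟩ } }
    have hκ : ∀ (U : X.AffineOpens) (c : SCong (structureMap f U.1)),
        Limits.colimit.desc (scongDiagram f) κ (scongι f U c) =
          Quotient.mk (scongSetoid f) ⟨U, c⟩ := fun U c =>
      ConcreteCategory.congr_hom (Limits.colimit.ι_desc κ U) c
    have := congrArg (Limits.colimit.desc (scongDiagram f) κ) h
    rw [hκ, hκ] at this
    exact Quotient.exact this
  · rintro ⟨W, h, h', e, rfl, rfl⟩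
    exact (scongι_scongRes f h e).trans (scongι_scongRes f h' e).symm

theorem isOpenEmbedding_scongι (U : X.AffineOpens) : Topology.IsOpenEmbedding (scongι f U) := by
  refine .of_continuous_injective_isOpenMap ?_ ?_ ?_
  · exact (Limits.colimit.ι (scongDiagram f) U).hom.continuous
  · intro c d h
    obtain ⟨W, h, h', e, rfl, rfl⟩ := (scongι_eq_iff f c d).1 h
    rfl
  · intro O hO
    refine (TopCat.colimit_isOpen_iff (scongDiagram f) _).2 fun V => ?_
    -- The trace of `O` on another affine piece is a union over the common affine opens `W`, and
    -- each term is open because the transition maps are open.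
    have : scongι f V ⁻¹' (scongι f U '' O) = ⋃ (W : X.AffineOpens) (h : W.1 ≤ U.1)
        (h' : W.1 ≤ V.1), scongRes f h' '' (scongRes f h ⁻¹' O) := by
      ext d
      simp only [Set.mem_iUnion]
      constructor
      · rintro ⟨c, hc, hcd⟩
        obtain ⟨W, h, h', e, rfl, rfl⟩ := (scongι_eq_iff f c d).1 hcd
        exact ⟨W, h, h', e, hc, rfl⟩
      · rintro ⟨W, h, h', e, he, rfl⟩
        exact ⟨_, he, (scongι_scongRes f h e).trans (scongι_scongRes f h' e).symm⟩
    refine this.symm ▸ ?_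
    refine isOpen_iUnion fun W => isOpen_iUnion fun h => isOpen_iUnion fun h' => ?_
    exact (W.2.isOpenEmbedding_scongRes V.2 h').isOpenMap _
      (hO.preimage (scongRes f h).continuous)

theorem isSober_scongSpace (hk : IsPointedDomain k) (hf : IsLocallyOfFiniteType f) :
    IsSober (scongSpace f) := by
  have : Nontrivial k := by
    obtain ⟨K, _, i, hi⟩ := hk
    exact ⟨0, 1, fun h => zero_ne_one (by rw [← map_zero i, h, map_one])⟩
  have : ∀ U : X.AffineOpens, QuasiSober (SCong (structureMap f U.1)) := fun U =>
    SCong.quasiSober hk _ (hf.isFinitelyGenerated U.2)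
  exact isSober_iff.2
    (quasiSober_and_t0Space_of_cover (scongι f) (isOpenEmbedding_scongι f) (exists_scongι_eq f))

end MonoidalSpace

end StrongCong

open StrongCong StrongCong.MonoidalSpace in
theorem mainTheorem5 {k : Type u} [CommMonoidWithZero k] (hk : IsPointedDomain k) :
    -- `SCong_k X` is sober for every `k`-scheme `X` locally of finite type
    (∀ (X : MonoidalSpace.{u}) (_ : X.IsMonoidScheme) (f : X ⟶ MSpec.space k),
      IsLocallyOfFiniteType f → IsSober (scongSpace f)) ∧
    -- `k` embeds into a field of characteristic zero
    (∃ (F : Type u) (_ : Field F) (i : k →*₀ F), CharZero F ∧ Function.Injective i) ∧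
    -- the affine case
    (∀ (B : Type v) [CommMonoidWithZero B] (f : k →*₀ B), IsFinitelyGenerated f →
      IsSober (SCong f) ∧ T0Space (SCong f) ∧
      ∀ (F : Type w) [Field F] (i : k →*₀ F), Function.Injective i →
        IsNoetherianRing (RelRing f i) ∧
        Continuous (specToCong (toRelRing f i)) ∧
        Set.range (specToCong (toRelRing f i)) ⊆ SCong f ∧
        (CharZero F → Set.range (specToCong (toRelRing f i)) = SCong f)) := by
  refine ⟨fun X _ f hf => isSober_scongSpace f hk hf, hk.exists_charZero, fun B _ f hf => ?_⟩
  have := SCong.quasiSober hk f hf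
  refine ⟨isSober_iff.2 ⟨this, inferInstance⟩, inferInstance, fun F _ i hi => ?_⟩
  have hsub : Set.range (specToCong (toRelRing f i)) ⊆ SCong f := by
    rintro _ ⟨p, rfl⟩
    exact specToCong_mem f i hi p
  exact ⟨isNoetherianRing_relRing hf i, continuous_specToCong _, hsub,
    fun _ => hsub.antisymm (SCong.subset_range_specToCong f i hi)⟩
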